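/- **Setting.** $n\ge 2$ agents form a synchronous oriented ring. $Q_{j,a}\ge 0$ is the number of items of color $j\in\{0,\dots,m-1\}$ held initially by agent $a$, where $m\ge n$, and $p=\max_{j,a}Q_{j,a}$. Each agent knows $n$, $m$, its own numbers $Q_{j,a}$ and its own identifier; identifiers are distinct and smaller than $n^{e}$ for a constant $e$ (so they have $O(\log n)$ bits). There is a global clock, all agents start in round $0$, and in each round every agent reads the messages sent to it by its two neighbours in the previous round, computes, and sends at most one message to each neighbour. A message of $L$ bits costs $1$ if $L\le c_1\log n$, and $c_2\lceil L/\log n\rceil$ otherwise, where $c_1,c_2>0$ are constants; a color in a message takes $\lceil\log m\rceil$ bits. A *Balanced Coloring* is a map $\pi$ from colors to agents with $\lfloor m/n\rfloor\le|\pi^{-1}(a)|\le\lceil m/n\rceil$ for every agent $a$. Logarithms are to base 2. **Algorithm Sync-Balance.** *Phase 1.* A leader is elected by the Hirschberg–Sinclair algorithm; it sends a message around the ring that tells every agent its label $i$, the clockwise distance from the leader. Call the agents $a_0$ (the leader), $a_1,\dots,a_{n-1}$. All agents enter Phase 2 in the same round. *Phase 2.* Let $p_i=\max_jQ_{j,a_i}$,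 and let $B_i(r)=1$ if $2^r\le p_i<2^{r+1}$ or $p_i=r=0$, and $B_i(r)=0$ otherwise. Stages $r=0,1,\dots$ take $n$ rounds each. In stage $r$, agent $a_i$ acts $i$ rounds after its beginning: it adds $B_i(r)$ to the number it has just received from $a_{i-1}$ ($0$ if none, or if $i=0$) and sends the sum clockwise if it is positive. At the end of the stage the leader adds the number received from $a_{n-1}$ to a total $A$, initially $0$. If $A<n$, the next stage begins; otherwise, $\ell$ being the stage just completed, it sends an end marker clockwise. Each agent reads $\ell$ off the clock when the marker arrives, sets $p'=2^{\ell+1}$, forwards the marker, waits $n-i+1$ rounds and enters Phase 3. *Phase 3.* Put $g=(\lfloor m/n\rfloor+1)n-m$, and let agent $a_i$ have quota $\mathcal K_i=\lfloor m/n\rfloor$ if $i<g$ and $\lfloor m/n\rfloor+1$ otherwise. Stages $r=0,\dots,\log p'$ use the intervals $I_0=[p'/2,\infty)$, $I_r=[p'/2^{r+1},p'/2^r)$ for $0<r<\log p'$, and $I_{\log p'}=[0,1)$. A color $j$ is assignable to $a_i$ in stage $r$ if it was not assigned in an earlier stage, $Q_{j,a_i}\in I_r$, and $a_i$ has not yet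 filled its quota. Step 1: agent $a_i$ acts $i$ rounds after the beginning of the stage. If a label $k$ has just arrived, it forwards it and begins Step 2 after $n+k-i-1$ rounds. Otherwise, if some color is assignable to it, it sends its label $i$ clockwise and begins Step 2 after $n-1$ rounds. Otherwise it waits $n$ rounds; if a label $k$ then arrives, it forwards it unless $k=i+1$ and begins Step 2 after $k-i-1$ rounds; if none arrives, it goes to the next stage after $n-i$ rounds, skipping Step 2. Step 2: agent $a_i$ acts $i$ rounds after the beginning of the step. It takes the list of colors that has just arrived (empty if none), assigns to itself as many of the assignable colors not on the list as its quota permits (by an arbitrary selection rule of the agent), adds them to the list, and sends the list clockwise if it is not empty. The next list it receives is the list of all colors assigned in this stage; it records these colors, forwards the list, halts if all colors are now assigned, and otherwise goes to the next stage after $n-i$ rounds. An agent also halts after stage $\log p'$. **Theorem (Sync-Balance).** Assume $m\in O(n^c)$ for a constant $c$. For every such ring, identifiers, initial distribution of items and selection rules, all agents executing Sync-Balance halt after $O(n\log\max(p,2))$ rounds; at that time the sets of colors that the agents have assigned to themselves are the fibres $\pi^{-1}(a)$ of a Balanced Coloring $\pi$; and the total cost of all messages sent is $\Theta(mn)$: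 on every instance it is at least $K_1mn$ and at most $K_2mn$. The positive constants in these bounds depend only on $c$, on the constant in $m\in O(n^c)$, and on $e$, $c_1$, $c_2$. -/

import Mathlib

namespace SyncBalance

/-! ## The synchronous ring -/

/-- The clockwise neighbour (the *following* neighbour) on the ring of `n` agents. -/
def next {n : ℕ} (a : Fin n) : Fin n :=
  ⟨(a.val + 1) % n, Nat.mod_lt _ a.pos⟩

/-- The anti-clockwise neighbour (the *preceding* neighbour) on the ring of `n` agents. -/
def prev {n : ℕ} (a : Fin n) : Fin n :=
  ⟨(a.val + n - 1) % n, Nat.mod_lt _ a.pos⟩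

/-- A deterministic protocol for a synchronous ring: `I` is the type of local inputs, `S` of local
states and `M` of messages.  In every round an agent looks at the global clock and at the messages
that its two neighbours sent to it in the previous round, updates its local state and sends at most
one message over each of its two links.  `act inp now s fromPrev fromNext` returns the new state,
the message sent clockwise and the message sent anti-clockwise. -/
structure RingProtocol (I S M : Type) where
  init : I → S
  act : I → ℕ → S → Option M → Option M → S × Option M × Option M

/-- A global configuration at the beginning of a round: all local states, and for each agent the
messages it sent clockwise and anti-clockwise in the previous round. -/
structure Config (n : ℕ) (S M : Type) where
  state : Fin n → S
  cw : Fin n → Option M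
  ccw : Fin n → Option M

namespace RingProtocol

variable {n : ℕ} {I S M : Type}

/-- What agent `a` does in round `now`, started in configuration `g`. -/
def local_act (P : RingProtocol I S M) (input : Fin n → I) (now : ℕ) (g : Config n S M)
    (a : Fin n) : S × Option M × Option M :=
  P.act (input a) now (g.state a) (g.cw (prev a)) (g.ccw (next a))

/-- The configuration at the beginning of round `t` (rounds are numbered from `0`). -/
def run (P : RingProtocol I S M) (input : Fin n → I) : ℕ → Config n S M
  | 0 => ⟨fun a => P.init (input a), fun _ => none, fun _ => none⟩
  | t + 1 =>
    let g := P.run input t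
    ⟨fun a => (P.local_act input t g a).1,
     fun a => (P.local_act input t g a).2.1,
     fun a => (P.local_act input t g a).2.2⟩

/-- The total charge for all messages sent in the rounds `0, …, T - 1`, if a message `x` is charged
`cost x`. -/
noncomputable def totalCost (P : RingProtocol I S M) (input : Fin n → I) (cost : M → ℝ)
    (T : ℕ) : ℝ :=
  ∑ t ∈ Finset.range T, ∑ a : Fin n,
    (((P.run input (t + 1)).cw a).elim 0 cost + ((P.run input (t + 1)).ccw a).elim 0 cost)

end RingProtocol

/-- The charge for a message of `L` bits on a ring of `n` agents: a basic message, i.e. one of at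
most `cBasic * log n` bits, is transmitted at unit cost; a longer one is charged
`cLong * ⌈L / log n⌉`. -/
noncomputable def bitCost (cBasic cLong : ℝ) (n L : ℕ) : ℝ :=
  if (L : ℝ) ≤ cBasic * Real.logb 2 n then 1
  else cLong * (⌈(L : ℝ) / Real.logb 2 n⌉₊ : ℝ)

/-! ## The problem -/

/-- A Balanced Coloring: an assignment of the `m` colors to the `n` agents that gives every agent at
least `⌊m / n⌋` and at most `⌈m / n⌉` colors. -/
def IsBalancedColoring {n m : ℕ} (π : Fin m → Fin n) : Prop :=
  ∀ a : Fin n, m / n ≤ (Finset.univ.filter fun j => π j = a).card ∧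
    (Finset.univ.filter fun j => π j = a).card ≤ m ⌈/⌉ n

/-- The largest number `p` of items of one color held by one agent; `Q j a` is the number of items
of color `j` that agent `a` holds initially. -/
def maxItems {n m : ℕ} (Q : Fin m → Fin n → ℕ) : ℕ :=
  Finset.univ.sup fun a => Finset.univ.sup fun j => Q j a

/-! ## Algorithm Sync-Balance -/

/-- What an agent knows at the start, besides the numbers `n` of agents and `m` of colors: its
identifier, the number of items it holds of each color, and a rule `choose L q` by which it selects
`q` colors (or all, if there are fewer) from a set `L`. -/
structure Input (m : ℕ) where
  id : ℕ
  weight : Fin m → ℕ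
  choose : Finset (Fin m) → ℕ → Finset (Fin m)

/-- The selection rule always selects as many colors as the quota `q` permits. -/
def SelectsMax {m : ℕ} (choose : Finset (Fin m) → ℕ → Finset (Fin m)) : Prop :=
  ∀ L q, choose L q ⊆ L ∧ (choose L q).card = min q L.card

/-- The messages. -/
inductive Msg (m : ℕ) where
  /-- Leader election: the identifier of a candidate, its current phase `k`, and the number of hops
  travelled so far.  It is to travel `2 ^ k` hops. -/
  | probe (id k hops : ℕ)
  /-- Leader election: the answer to a probe that has travelled `2 ^ k` hops. -/
  | reply (id k : ℕ)
  /-- From the elected leader clockwise: tells each agent its label. -/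
  | label (i : ℕ)
  /-- Phase 2: number of agents that spoke up so far in this stage. -/
  | count (c : ℕ)
  /-- Phase 2 is over.  The index of the last stage is known to the receiver from the clock. -/
  | finish
  /-- Phase 3, Step 1: label of the first agent that can assign itself some color. -/
  | speaker (k : ℕ)
  /-- Phase 3, Step 2: a list of colors assigned in this stage. -/
  | colors (l : Finset (Fin m))
  deriving DecidableEq

/-- Number of bits of a self-delimiting code of the number `x`. -/
def natBits (x : ℕ) : ℕ := 2 * Nat.size x + 2

/-- Bit length of a message: three bits for its kind, then its contents; each color in a list takes
`⌈log m⌉` bits. -/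
def Msg.bits {m : ℕ} : Msg m → ℕ
  | .probe id k hops => 3 + natBits id + natBits k + natBits hops
  | .reply id k => 3 + natBits id + natBits k
  | .label i => 3 + natBits i
  | .count c => 3 + natBits c
  | .finish => 3
  | .speaker k => 3 + natBits k
  | .colors l => 3 + l.card * Nat.clog 2 m

/-- Where an agent is in its program.  `start` is the round in which the current stage or step
begins; as long as it lies in the future, the agent waits. -/
inductive Mode where
  /-- Phase 1. -/
  | elect
  /-- Phase 2, stage `r`. -/
  | estimate (start r : ℕ)
  /-- Phase 3, stage `r`, Step 1. -/
  | step1 (start r : ℕ)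
  /-- Phase 3, stage `r`, Step 2. -/
  | step2 (start r : ℕ)
  | halted
  deriving DecidableEq

/-- The local variables of an agent. -/
structure AgentState (m : ℕ) where
  mode : Mode
  /-- Phase 1: current phase of the election. -/
  hsPhase : ℕ
  /-- Phase 1: a reply to the own probe has come back from the preceding neighbour. -/
  gotPrev : Bool
  /-- Phase 1: a reply to the own probe has come back from the following neighbour. -/
  gotNext : Bool
  /-- The label: distance from the leader, clockwise. -/
  label : ℕ
  /-- Phase 2, variable `A` of the leader: number of agents that have spoken up. -/
  spoken : ℕ
  /-- The estimate `p'` of `p`, computed in Phase 2. -/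
  pUB : ℕ
  /-- Phase 3: all colors known to be assigned in the completed stages. -/
  assigned : Finset (Fin m)
  /-- Phase 3: the colors the agent has assigned to itself. -/
  mine : Finset (Fin m)

/-- New state, message sent clockwise, message sent anti-clockwise. -/
abbrev Action (m : ℕ) : Type := AgentState m × Option (Msg m) × Option (Msg m)

variable {m : ℕ}

/-- All agents start as candidates in phase `0` of the election. -/
def initState : AgentState m where
  mode := .elect
  hsPhase := 0
  gotPrev := false
  gotNext := false
  label := 0
  spoken := 0
  pUB := 0
  assigned := ∅
  mine := ∅

/-! ### Phase 1: leader election of Hirschberg and Sinclair, then labelling -/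

/-- What the agent `me` passes on, in the direction of travel, when `x` arrives. -/
def onward (me : ℕ) (x : Option (Msg m)) : Option (Msg m) :=
  match x with
  | some (.probe j k d) => if me < j ∧ d < 2 ^ k then some (.probe j k (d + 1)) else none
  | some (.reply j k) => if j ≠ me then some (.reply j k) else none
  | _ => none

/-- What the agent `me` sends back to where `x` came from, when `x` arrives. -/
def back (me : ℕ) (x : Option (Msg m)) : Option (Msg m) :=
  match x with
  | some (.probe j k d) => if me < j ∧ 2 ^ k ≤ d then some (.reply j k) else none
  | _ => none

/-- `x` is the reply to a probe of the agent `me`. -/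
def isOwnReply (me : ℕ) (x : Option (Msg m)) : Bool :=
  match x with
  | some (.reply j _) => j = me
  | _ => false

/-- A candidate sends probes in both directions; each is to travel `2 ^ k` hops in phase `k`, is
swallowed by an agent with a larger identifier, and is answered by a reply otherwise.  A candidate
that gets both replies enters the next phase.  An agent that is reached by its own probe has the
largest identifier and becomes the leader; it sends a message around the ring that tells every
agent its label.  All agents start Phase 2 in the same round. -/
def electAct (n : ℕ) (inp : Input m) (now : ℕ) (s : AgentState m)
    (fromPrev fromNext : Option (Msg m)) : Action m :=
  if now = 0 then (s, some (.probe inp.id 0 1), some (.probe inp.id 0 1))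
  else
    let relay : Action m :=
      let gp := s.gotPrev || isOwnReply inp.id fromPrev
      let gn := s.gotNext || isOwnReply inp.id fromNext
      if gp && gn then
        ({ s with hsPhase := s.hsPhase + 1, gotPrev := false, gotNext := false },
          some (.probe inp.id (s.hsPhase + 1) 1), some (.probe inp.id (s.hsPhase + 1) 1))
      else
        ({ s with gotPrev := gp, gotNext := gn },
          (onward inp.id fromPrev).or (back inp.id fromNext),
          (onward inp.id fromNext).or (back inp.id fromPrev))
    match fromPrev with
    | some (.probe j _ _) =>
      if j = inp.id then
        ({ s with label := 0, mode := .estimate (now + n) 0 }, some (.label 1), none)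
      else relay
    | some (.label i) =>
      ({ s with label := i, mode := .estimate (now + (n - i)) 0 },
        if i + 1 < n then some (.label (i + 1)) else none, none)
    | _ => relay

/-! ### Phase 2: estimating `p` -/

/-- `B r`: whether the agent speaks up in stage `r`. -/
def speaksUp (inp : Input m) (r : ℕ) : ℕ :=
  let pi := Finset.univ.sup inp.weight
  if (pi = 0 ∧ r = 0) ∨ (2 ^ r ≤ pi ∧ pi < 2 ^ (r + 1)) then 1 else 0

/-- The number in a counting message, `0` if there is none. -/
def countOf (x : Option (Msg m)) : ℕ :=
  match x with
  | some (.count c) => c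
  | _ => 0

/-- Stage `r` takes `n` time units.  The agent with label `i` acts `i` time units after the
beginning of the stage.  What the leader receives at that time is the result of stage `r - 1`. -/
def estimateAct (n : ℕ) (inp : Input m) (now : ℕ) (s : AgentState m) (start r : ℕ)
    (fromPrev : Option (Msg m)) : Action m :=
  if now = start + s.label then
    let finished : Action m :=
      ({ s with pUB := 2 ^ ((r - 1) + 1), mode := .step1 (now + (n - s.label + 1)) 0 },
        some .finish, none)
    let go (c : ℕ) (s' : AgentState m) : Action m :=
      ({ s' with mode := .estimate (start + n) (r + 1) },
        if 0 < c then some (.count c) else none, none)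
    if s.label = 0 then
      let A := s.spoken + countOf fromPrev
      if n ≤ A then finished else go (speaksUp inp r) { s with spoken := A }
    else if fromPrev = some .finish then finished
    else go (countOf fromPrev + speaksUp inp r) s
  else (s, none, none)

/-! ### Phase 3: assigning the colors -/

/-- The number of colors the agent with label `i` has to assign to itself. -/
def quota (n m i : ℕ) : ℕ :=
  if i < (m / n + 1) * n - m then m / n else m / n + 1

/-- `q` lies in the interval `I_r` that belongs to the estimate `p'` (a power of two):
`I_0 = [p'/2, ∞)`, `I_r = [p'/2^(r+1), p'/2^r)` for `0 < r < log p'`, and `I_(log p') = [0, 1)`. -/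
def InInterval (p' r q : ℕ) : Prop :=
  if r = 0 then p' / 2 ≤ q
  else if r < Nat.log 2 p' then p' / 2 ^ (r + 1) ≤ q ∧ q < p' / 2 ^ r
  else r = Nat.log 2 p' ∧ q < 1

instance (p' r q : ℕ) : Decidable (InInterval p' r q) := by
  unfold InInterval; infer_instance

/-- The colors assignable to the agent in stage `r`: those not assigned in previous stages and with
a weight in `I_r`; an agent that already has as many colors as it has to take can assign itself
none. -/
def assignable (n : ℕ) (inp : Input m) (s : AgentState m) (r : ℕ) : Finset (Fin m) :=
  if s.mine.card < quota n m s.label then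
    Finset.univ.filter fun j => j ∉ s.assigned ∧ InInterval s.pUB r (inp.weight j)
  else ∅

/-- The list in a color message, empty if there is none. -/
def colorsOf (x : Option (Msg m)) : Finset (Fin m) :=
  match x with
  | some (.colors l) => l
  | _ => ∅

/-- Continue with stage `r + 1`, from round `start` on, if there is such a stage. -/
def nextStage (s : AgentState m) (start r : ℕ) : Mode :=
  if r + 1 ≤ Nat.log 2 s.pUB then .step1 start (r + 1) else .halted

/-- Step 2 of stage `r`. -/
def step2Act (n : ℕ) (inp : Input m) (now : ℕ) (s : AgentState m) (start r : ℕ)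
    (fromPrev : Option (Msg m)) : Action m :=
  if now = start + s.label then
    let l := colorsOf fromPrev
    let new := inp.choose (assignable n inp s r \ l) (quota n m s.label - s.mine.card)
    ({ s with mine := s.mine ∪ new, mode := .step2 start r },
      if l ∪ new = ∅ then none else some (.colors (l ∪ new)), none)
  else if start + s.label < now then
    match fromPrev with
    | some (.colors l) =>
      let s' := { s with assigned := s.assigned ∪ l }
      ({ s' with mode :=
          if s'.assigned = Finset.univ then .halted else nextStage s' (now + (n - s.label)) r },
        some (.colors l), none)
    | _ => (s, none, none)
  else (s, none, none)

/-- Step 1 of stage `r`.  `i` is the label of the agent. -/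
def step1Act (n : ℕ) (inp : Input m) (now : ℕ) (s : AgentState m) (start r : ℕ)
    (fromPrev : Option (Msg m)) : Action m :=
  let i := s.label
  if now = start + i then
    match fromPrev with
    | some (.speaker k) =>
      ({ s with mode := .step2 (now + (n + k - i - 1)) r }, some (.speaker k), none)
    | _ =>
      if assignable n inp s r ≠ ∅ then
        ({ s with mode := .step2 (now + (n - 1)) r }, some (.speaker i), none)
      else (s, none, none)
  else if now = start + i + n then
    match fromPrev with
    | some (.speaker k) =>
      if k - i - 1 = 0 then step2Act n inp now { s with mode := .step2 now r } now r none
      else ({ s with mode := .step2 (now + (k - i - 1)) r }, some (.speaker k), none)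
    | _ => ({ s with mode := nextStage s (now + (n - i)) r }, none, none)
  else (s, none, none)

/-- The local inputs for given identifiers, numbers of items and selection rules. -/
def inputs {n : ℕ} (id : Fin n → ℕ) (Q : Fin m → Fin n → ℕ)
    (choose : Fin n → Finset (Fin m) → ℕ → Finset (Fin m)) (a : Fin n) : Input m where
  id := id a
  weight j := Q j a
  choose := choose a

/-- Algorithm Sync-Balance for `n` agents and `m` colors.  A halted agent does nothing any more. -/
def syncBalance (n m : ℕ) : RingProtocol (Input m) (AgentState m) (Msg m) where
  init _ := initState
  act inp now s fromPrev fromNext :=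
    match s.mode with
    | .elect => electAct n inp now s fromPrev fromNext
    | .estimate start r => estimateAct n inp now s start r fromPrev
    | .step1 start r => step1Act n inp now s start r fromPrev
    | .step2 start r => step2Act n inp now s start r fromPrev
    | .halted => (s, none, none)

/-- The configuration of Sync-Balance at the beginning of round `t`. -/
def config {n : ℕ} (id : Fin n → ℕ) (Q : Fin m → Fin n → ℕ)
    (choose : Fin n → Finset (Fin m) → ℕ → Finset (Fin m)) (t : ℕ) :
    Config n (AgentState m) (Msg m) :=
  (syncBalance n m).run (inputs id Q choose) t

/-- The total charge for the messages that Sync-Balance sends before round `T`. -/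
noncomputable def messageCost {n : ℕ} (cBasic cLong : ℝ) (id : Fin n → ℕ) (Q : Fin m → Fin n → ℕ)
    (choose : Fin n → Finset (Fin m) → ℕ → Finset (Fin m)) (T : ℕ) : ℝ :=
  (syncBalance n m).totalCost (inputs id Q choose) (fun x => bitCost cBasic cLong n x.bits) T

end SyncBalance

/-! Apart from the selection rules the run is determined, so it is followed exactly and its charges
are counted along the way.

Phase 1. In phase `k` of the election the surviving candidates are the agents with the largest
identifier within distance `2 ^ (k - 1)` (`0` for `k = 0`) on both sides, and the probe of a
candidate is alive after some hops exactly if all agents passed have smaller identifiers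
(`Candidate`, `Probes`, `Replies`). In the first phase with `2 ^ k ≥ n` only the probe of the
largest identifier comes full circle (`exists_leader`). This takes `O(n)` rounds. Charging two
messages to every agent in every round gives `O(n²)`, which is good enough since `n ≤ m`.

From then on all messages travel clockwise, and nearly all activity consists of waves in which one
agent after the other acts. `sweep` derives the effect of a wave on the global configuration from
the local rule.

Phase 2. Every agent speaks up in exactly one stage. A stage with `q` speakers costs `O(n q)`, in
particular nothing if `q = 0`, so the stages together cost `O(n²)` (`phase_two`).

Phase 3. The invariant `PartialAssignment` says that an agent which has passed over a color that is
still free has filled its quota. A color left after the last stage has been passed over by all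
agents, so all quotas would be filled; but they add up to `m` (`PartialAssignment.eq_univ`). The
same count shows that every quota is met exactly. A stage that assigns `q > 0` colors sends the
complete list once around the ring, which costs at least a constant times `n q`, and the rest of the
stage is `O(n q)` as well; a stage that assigns nothing is free (`AssignStage.exists_stageEnd`).
Summation over the stages gives `Θ(mn)`. That a list of `q > 0` colors costs `Θ(q)` is part of
`costBounds`: `log m` and `log n` have the same order. -/

namespace SyncBalance

/-! ### Arithmetic of the oriented ring. -/

section Ring

variable {n : ℕ}

theorem next_prev (a : Fin n) : next (prev a) = a := by
  apply Fin.ext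
  have h := a.isLt
  simp only [next, prev]
  rcases Nat.eq_zero_or_pos a.val with h0 | h0
  · rw [h0, Nat.mod_eq_of_lt (by omega : 0 + n - 1 < n), (by omega : 0 + n - 1 + 1 = n),
      Nat.mod_self]
  · rw [(by omega : a.val + n - 1 = a.val - 1 + n), Nat.add_mod_right,
      Nat.mod_eq_of_lt (by omega : a.val - 1 < n), Nat.mod_eq_of_lt (by omega)]
    omega

theorem next_injective : Function.Injective (next : Fin n → Fin n) :=
  Finite.injective_iff_surjective.2 fun a => ⟨prev a, next_prev a⟩

theorem prev_next (a : Fin n) : prev (next a) = a :=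
  next_injective (next_prev (next a))

theorem prev_injective : Function.Injective (prev : Fin n → Fin n) :=
  Function.LeftInverse.injective next_prev

theorem next_eq_iff {a b : Fin n} : next a = b ↔ a = prev b :=
  ⟨fun h => by rw [← h, prev_next], fun h => by rw [h, next_prev]⟩

theorem val_iterate_next (a : Fin n) (i : ℕ) : (next^[i] a).val = (a.val + i) % n := by
  induction i with
  | zero => simp [Nat.mod_eq_of_lt a.isLt]
  | succ i ih =>
    rw [Function.iterate_succ_apply']
    simp only [next, ih, Nat.mod_add_mod, Nat.add_assoc]

theorem iterate_next_card (a : Fin n) : next^[n] a = a := by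
  apply Fin.ext
  rw [val_iterate_next, Nat.add_mod_right, Nat.mod_eq_of_lt a.isLt]

/-- The clockwise distance from `L` to `a`. -/
def dist (L a : Fin n) : ℕ := (a.val + (n - L.val)) % n

theorem dist_lt (L a : Fin n) : dist L a < n := Nat.mod_lt _ a.pos

theorem dist_iterate_next (L : Fin n) {i : ℕ} (hi : i < n) : dist L (next^[i] L) = i := by
  have h := L.isLt
  rw [dist, val_iterate_next, Nat.mod_add_mod, (by omega : L.val + i + (n - L.val) = i + n),
    Nat.add_mod_right, Nat.mod_eq_of_lt hi]

theorem iterate_next_dist (L a : Fin n) : next^[dist L a] L = a := by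
  apply Fin.ext
  have h := L.isLt
  rw [val_iterate_next, dist, Nat.add_mod_mod, (by omega : L.val + (a.val + (n - L.val)) = a.val + n),
    Nat.add_mod_right, Nat.mod_eq_of_lt a.isLt]

theorem dist_eq_iff (L a : Fin n) {i : ℕ} (hi : i < n) : dist L a = i ↔ a = next^[i] L :=
  ⟨fun h => by rw [← h, iterate_next_dist], fun h => by rw [h, dist_iterate_next L hi]⟩

theorem dist_self (L : Fin n) : dist L L = 0 := dist_iterate_next L (i := 0) L.pos

theorem dist_injective (L : Fin n) : Function.Injective (dist L) := fun a b h => by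
  rw [← iterate_next_dist L a, h, iterate_next_dist]

theorem iterate_next_prev (a : Fin n) (i : ℕ) : next^[i] (prev^[i] a) = a :=
  Function.LeftInverse.iterate next_prev i a

theorem iterate_prev_next (a : Fin n) (i : ℕ) : prev^[i] (next^[i] a) = a :=
  Function.LeftInverse.iterate prev_next i a

theorem iterate_next_ne (a : Fin n) {i : ℕ} (h0 : 0 < i) (hi : i < n) : next^[i] a ≠ a := by
  intro h
  have := dist_iterate_next a hi
  rw [h, dist_self] at this
  omega

theorem iterate_prev_ne (a : Fin n) {i : ℕ} (h0 : 0 < i) (hi : i < n) : prev^[i] a ≠ a := by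
  intro h
  apply iterate_next_ne a h0 hi
  conv_lhs => rw [← h]
  rw [iterate_next_prev]

theorem iterate_prev_card (a : Fin n) : prev^[n] a = a := by
  conv_lhs => rw [← iterate_next_card a]
  rw [iterate_prev_next]

/-- This locates the sender of the last hop of a probe that comes full circle. -/
theorem prev_eq_iterate_next (a : Fin n) : prev a = next^[n - 1] a := by
  apply next_injective
  rw [next_prev, ← Function.iterate_succ_apply' next, Nat.succ_eq_add_one,
    Nat.sub_add_cancel a.pos, iterate_next_card]

theorem next_eq_iterate_prev (a : Fin n) : next a = prev^[n - 1] a := by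
  apply prev_injective
  rw [prev_next, ← Function.iterate_succ_apply' prev, Nat.succ_eq_add_one,
    Nat.sub_add_cancel a.pos, iterate_prev_card]

/-- Sums over agents become sums over labels, since `dist L` is a bijection onto `0, …, n - 1`. -/
theorem sum_dist {M : Type*} [AddCommMonoid M] (L : Fin n) (f : ℕ → M) :
    ∑ a : Fin n, f (dist L a) = ∑ i ∈ Finset.range n, f i := by
  refine Finset.sum_bij (fun a _ => dist L a) (fun a _ => Finset.mem_range.2 (dist_lt L a))
    (fun a _ b _ h => dist_injective L h) (fun i hi => ?_) (fun _ _ => rfl)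
  exact ⟨next^[i] L, Finset.mem_univ _, dist_iterate_next L (Finset.mem_range.1 hi)⟩

end Ring

/-! ### Single rounds and clockwise waves. -/

section Rounds

variable {n m : ℕ} (inp : Fin n → Input m) (cost : Msg m → ℝ)

/-- Once the leader is known nothing travels anti-clockwise, so configurations keep this shape and a
round can be checked agent by agent. -/
theorem run_succ_eq {t : ℕ} {st st' : Fin n → AgentState m} {w w' : Fin n → Option (Msg m)}
    (h : (syncBalance n m).run inp t = ⟨st, w, fun _ => none⟩)
    (hstep : ∀ a, (syncBalance n m).act (inp a) t (st a) (w (prev a)) none = (st' a, w' a, none)) :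
    (syncBalance n m).run inp (t + 1) = ⟨st', w', fun _ => none⟩ := by
  simp only [RingProtocol.run, RingProtocol.local_act, h, hstep]

theorem totalCost_succ {t : ℕ} {st : Fin n → AgentState m} {w : Fin n → Option (Msg m)}
    (h : (syncBalance n m).run inp (t + 1) = ⟨st, w, fun _ => none⟩) :
    (syncBalance n m).totalCost inp cost (t + 1) =
      (syncBalance n m).totalCost inp cost t + ∑ a, (w a).elim 0 cost := by
  simp only [RingProtocol.totalCost]
  rw [Finset.sum_range_succ, h]
  simp

/-- Only the agent `p` is about to receive a message from its predecessor, namely `x`. -/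
def toward (p : Fin n) (x : Option (Msg m)) (a : Fin n) : Option (Msg m) :=
  if next a = p then x else none

theorem toward_prev (p : Fin n) (x : Option (Msg m)) (a : Fin n) :
    toward p x (prev a) = if a = p then x else none := by
  rw [toward, next_prev]

theorem toward_none (p : Fin n) (a : Fin n) : toward p (none : Option (Msg m)) a = none := by
  simp [toward]

theorem sum_toward (p : Fin n) (x : Option (Msg m)) :
    ∑ a, (toward p x a).elim 0 cost = x.elim 0 cost := by
  rw [Finset.sum_eq_single (prev p)]
  · simp [toward, next_prev]
  · intro b _ hb
    rw [toward, if_neg]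
    · rfl
    · exact fun h => hb (next_eq_iff.1 h)
  · simp

/-- The agents at clockwise distance less than `j` from `L` have changed their state from `st₀` to
`st₁`. -/
def front (L : Fin n) (st₀ st₁ : Fin n → AgentState m) (j : ℕ) (a : Fin n) : AgentState m :=
  if dist L a < j then st₁ a else st₀ a

theorem front_zero (L : Fin n) (st₀ st₁ : Fin n → AgentState m) : front L st₀ st₁ 0 = st₀ := by
  funext a; simp [front]

theorem front_card (L : Fin n) (st₀ st₁ : Fin n → AgentState m) : front L st₀ st₁ n = st₁ := by
  funext a; simp [front, dist_lt]

/-- A wave of activity that travels clockwise: the agents at distance `i = j₀, …, j₁ - 1` from `L`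
act one after the other, agent `i` on the message `x i` of its predecessor, and all others are
idle. -/
theorem sweep (L : Fin n) (S j₀ j₁ : ℕ) (h01 : j₀ ≤ j₁) (hn : j₁ ≤ n)
    (st₀ st₁ : Fin n → AgentState m) (x : ℕ → Option (Msg m))
    (pre : ∀ a t, S + j₀ ≤ t → t < S + dist L a → t < S + j₁ →
      (syncBalance n m).act (inp a) t (st₀ a) none none = (st₀ a, none, none))
    (mid : ∀ a, j₀ ≤ dist L a → dist L a < j₁ →
      (syncBalance n m).act (inp a) (S + dist L a) (st₀ a) (x (dist L a)) none =
        (st₁ a, x (dist L a + 1), none))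
    (post : ∀ a t, S + j₀ ≤ t → S + dist L a < t → t < S + j₁ →
      (syncBalance n m).act (inp a) t (st₁ a) none none = (st₁ a, none, none))
    (h : (syncBalance n m).run inp (S + j₀) =
      ⟨front L st₀ st₁ j₀, toward (next^[j₀] L) (x j₀), fun _ => none⟩) :
    (syncBalance n m).run inp (S + j₁) =
      ⟨front L st₀ st₁ j₁, toward (next^[j₁] L) (x j₁), fun _ => none⟩ ∧
    (syncBalance n m).totalCost inp cost (S + j₁) =
      (syncBalance n m).totalCost inp cost (S + j₀) +
        ∑ i ∈ Finset.Ico j₀ j₁, (x (i + 1)).elim 0 cost := by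
  induction j₁, h01 using Nat.le_induction with
  | base => simpa using h
  | succ j hj ih =>
    obtain ⟨ih1, ih2⟩ := ih (by omega) (fun a t h1 h2 h3 => pre a t h1 h2 (by omega))
      (fun a h1 h2 => mid a h1 (by omega)) (fun a t h1 h2 h3 => post a t h1 h2 (by omega))
    have key : (syncBalance n m).run inp (S + j + 1) =
      ⟨front L st₀ st₁ (j + 1), toward (next^[j + 1] L) (x (j + 1)), fun _ => none⟩ := by
      refine run_succ_eq inp ih1 fun a => ?_
      have hd := dist_eq_iff L a (i := j) (by omega)
      rw [toward_prev, toward, Function.iterate_succ_apply']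
      have hinj : next a = next (next^[j] L) ↔ a = next^[j] L := next_injective.eq_iff
      simp only [hinj, ← hd, front]
      -- The wave has passed `a`, is just at `a`, or has yet to reach `a`.
      rcases lt_trichotomy (dist L a) j with hlt | heq | hgt
      · rw [if_pos hlt, if_neg (by omega), if_pos (by omega), if_neg (by omega)]
        exact post a _ (by omega) (by omega) (by omega)
      · rw [if_neg (by omega), if_pos heq, if_pos (by omega), if_pos heq]
        have := mid a (by omega) (by omega)
        rwa [heq] at this
      · rw [if_neg (by omega), if_neg (by omega), if_neg (by omega), if_neg (by omega)]
        exact pre a _ (by omega) (by omega) (by omega)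
    refine ⟨key, ?_⟩
    rw [← Nat.add_assoc, totalCost_succ inp cost key, ih2, sum_toward, Finset.sum_Ico_succ_top hj,
      add_assoc]

/-- A wave that visits all agents. -/
theorem full_sweep (L : Fin n) (S : ℕ)
    (st₀ st₁ : Fin n → AgentState m) (x : ℕ → Option (Msg m))
    (pre : ∀ a t, S ≤ t → t < S + dist L a →
      (syncBalance n m).act (inp a) t (st₀ a) none none = (st₀ a, none, none))
    (mid : ∀ a,
      (syncBalance n m).act (inp a) (S + dist L a) (st₀ a) (x (dist L a)) none =
        (st₁ a, x (dist L a + 1), none))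
    (post : ∀ a t, S + dist L a < t → t < S + n →
      (syncBalance n m).act (inp a) t (st₁ a) none none = (st₁ a, none, none))
    (h : (syncBalance n m).run inp S = ⟨st₀, toward L (x 0), fun _ => none⟩) :
    (syncBalance n m).run inp (S + n) = ⟨st₁, toward L (x n), fun _ => none⟩ ∧
    (syncBalance n m).totalCost inp cost (S + n) =
      (syncBalance n m).totalCost inp cost S +
        ∑ i ∈ Finset.range n, (x (i + 1)).elim 0 cost := by
  have := sweep inp cost L S 0 n (Nat.zero_le _) le_rfl st₀ st₁ x
    (fun a t h1 h2 _ => pre a t h1 h2) (fun a _ _ => mid a)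
    (fun a t _ h2 h3 => post a t h2 h3) (by simpa [front_zero] using h)
  rwa [front_card, iterate_next_card, Nat.Ico_zero_eq_range] at this

theorem act_elect {i : Input m} {t : ℕ} {s : AgentState m} {x y : Option (Msg m)}
    (h : s.mode = .elect) : (syncBalance n m).act i t s x y = electAct n i t s x y := by
  simp only [syncBalance, h]

theorem act_estimate {i : Input m} {t S r : ℕ} {s : AgentState m} {x y : Option (Msg m)}
    (h : s.mode = .estimate S r) :
    (syncBalance n m).act i t s x y = estimateAct n i t s S r x := by
  simp only [syncBalance, h]

theorem act_step1 {i : Input m} {t S r : ℕ} {s : AgentState m} {x y : Option (Msg m)}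
    (h : s.mode = .step1 S r) :
    (syncBalance n m).act i t s x y = step1Act n i t s S r x := by
  simp only [syncBalance, h]

theorem act_step2 {i : Input m} {t S r : ℕ} {s : AgentState m} {x y : Option (Msg m)}
    (h : s.mode = .step2 S r) :
    (syncBalance n m).act i t s x y = step2Act n i t s S r x := by
  simp only [syncBalance, h]

theorem act_halted {i : Input m} {t : ℕ} {s : AgentState m} {x y : Option (Msg m)}
    (h : s.mode = .halted) :
    (syncBalance n m).act i t s x y = (s, none, none) := by
  simp only [syncBalance, h]

end Rounds

/-! ### Probes and replies of the Hirschberg–Sinclair election. -/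

section Election

variable {n m : ℕ}

/-- The bounds on the charges of messages of Sync-Balance from which its total cost is bounded. -/
structure CostBounds (inp : Fin n → Input m) (cost : Msg m → ℝ) (lo hi : ℝ) : Prop where
  nonneg : ∀ x, 0 ≤ cost x
  hi_nonneg : 0 ≤ hi
  probe : ∀ b k d, k ≤ n → d ≤ n → cost (.probe (inp b).id k d) ≤ hi
  reply : ∀ b k, k ≤ n → cost (.reply (inp b).id k) ≤ hi
  label : ∀ i, i ≤ n → cost (.label i) ≤ hi
  count : ∀ i, i ≤ n → cost (.count i) ≤ hi
  finish : cost .finish ≤ hi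
  speaker : ∀ i, i ≤ n → cost (.speaker i) ≤ hi
  colors_le : ∀ l : Finset (Fin m), l.Nonempty → cost (.colors l) ≤ hi * l.card
  le_colors : ∀ l : Finset (Fin m), lo * l.card ≤ cost (.colors l)

/-- All agents that `b` reaches by at most `d` steps `f` have smaller identifiers. -/
def Beats (u : Fin n → ℕ) (f : Fin n → Fin n) (d : ℕ) (b : Fin n) : Prop :=
  ∀ i, 0 < i → i ≤ d → u (f^[i] b) < u b

theorem beats_succ {u : Fin n → ℕ} {f : Fin n → Fin n} {d : ℕ} {b : Fin n} :
    Beats u f (d + 1) b ↔ Beats u f d b ∧ u (f^[d + 1] b) < u b := by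
  constructor
  · exact fun h => ⟨fun i h0 hi => h i h0 (by omega), h _ (by omega) le_rfl⟩
  · rintro ⟨h, h'⟩ i h0 hi
    rcases Nat.lt_or_ge d i with hd | hd
    · rwa [(by omega : i = d + 1)]
    · exact h i h0 hd

theorem Beats.mono {u : Fin n → ℕ} {f : Fin n → Fin n} {d d' : ℕ} {b : Fin n}
    (h : Beats u f d b) (hd : d' ≤ d) : Beats u f d' b :=
  fun i h0 hi => h i h0 (hi.trans hd)

/-- `b` is still a candidate in phase `k` of the election. -/
def Candidate (u : Fin n → ℕ) (k : ℕ) (b : Fin n) : Prop :=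
  Beats u next (2 ^ k / 2) b ∧ Beats u prev (2 ^ k / 2) b

/-- The two halves on the right are the conditions for the two replies of phase `k` to exist; this
is why `Candidate u k b` is repeated. For `k = 0` the distance `2 ^ k / 2` is `0`, so everyone
starts as a candidate. -/
theorem candidate_succ {u : Fin n → ℕ} {k : ℕ} {b : Fin n} :
    Candidate u (k + 1) b ↔
      (Candidate u k b ∧ Beats u next (2 ^ k) b) ∧ (Candidate u k b ∧ Beats u prev (2 ^ k) b) := by
  have h : 2 ^ (k + 1) / 2 = 2 ^ k := by rw [pow_succ]; omega
  have h' : 2 ^ k / 2 ≤ 2 ^ k := Nat.div_le_self _ _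
  simp only [Candidate, h]
  constructor
  · rintro ⟨h1, h2⟩
    exact ⟨⟨⟨h1.mono h', h2.mono h'⟩, h1⟩, ⟨⟨h1.mono h', h2.mono h'⟩, h2⟩⟩
  · rintro ⟨⟨-, h1⟩, -, h2⟩
    exact ⟨h1, h2⟩

open Classical in
/-- The messages `M` in direction `f` are the probes of phase `k` after `d + 1` hops. -/
def Probes (u : Fin n → ℕ) (f : Fin n → Fin n) (k d : ℕ) (M : Fin n → Option (Msg m)) : Prop :=
  ∀ b, M (f^[d] b) =
    if Candidate u k b ∧ Beats u f d b then some (.probe (u b) k (d + 1)) else none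

open Classical in
/-- The messages `M` are the replies of phase `k` to the probes sent in direction `f`; they
are sent from distance `d` of the agents to which they are to return. -/
def Replies (u : Fin n → ℕ) (f : Fin n → Fin n) (k d : ℕ) (M : Fin n → Option (Msg m)) : Prop :=
  ∀ b, M (f^[d] b) =
    if Candidate u k b ∧ Beats u f (2 ^ k) b then some (.reply (u b) k) else none

/-- `Probes` describes messages by their origin. As `g^[d]` finds the origin that belongs to a
place, the message at every place is known. -/
theorem Probes.eq_none_or {u : Fin n → ℕ} {f g : Fin n → Fin n} (hfg : ∀ a, f (g a) = a)
    {k d : ℕ} {M : Fin n → Option (Msg m)} (h : Probes u f k d M) (a : Fin n) :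
    M a = none ∨ ∃ b, f^[d] b = a ∧ Beats u f d b ∧ M a = some (.probe (u b) k (d + 1)) := by
  have ha : f^[d] (g^[d] a) = a := Function.LeftInverse.iterate hfg d a
  have := h (g^[d] a)
  rw [ha] at this
  split_ifs at this with hc
  · exact Or.inr ⟨_, ha, hc.2, this⟩
  · exact Or.inl this

theorem Replies.eq_none_or {u : Fin n → ℕ} {f g : Fin n → Fin n} (hfg : ∀ a, f (g a) = a)
    {k d : ℕ} {M : Fin n → Option (Msg m)} (h : Replies u f k d M) (a : Fin n) :
    M a = none ∨ ∃ b, f^[d] b = a ∧ Beats u f (2 ^ k) b ∧ M a = some (.reply (u b) k) := by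
  have ha : f^[d] (g^[d] a) = a := Function.LeftInverse.iterate hfg d a
  have := h (g^[d] a)
  rw [ha] at this
  split_ifs at this with hc
  · exact Or.inr ⟨_, ha, hc.2, this⟩
  · exact Or.inl this

/-- All hop counters are below `2 ^ k`, so no reply is generated, and a probe survives the hop
exactly if one more agent has a smaller identifier. -/
theorem Probes.forward {u : Fin n → ℕ} {f g : Fin n → Fin n} (hgf : ∀ a, g (f a) = a)
    {k d : ℕ} {M N M' : Fin n → Option (Msg m)}
    (h : Probes u f k d M) (hN : Probes u g k d N) (hd : d + 1 < 2 ^ k)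
    (hM' : ∀ a, M' a = (onward (u a) (M (g a))).or (back (u a) (N (f a)))) :
    Probes u f k (d + 1) M' := by
  intro b
  rw [hM', Function.iterate_succ_apply', hgf, h b]
  have hback : back (u (f (f^[d] b))) (N (f (f (f^[d] b)))) = none := by
    rcases hN.eq_none_or hgf (f (f (f^[d] b))) with h | ⟨c, -, -, h⟩
    · rw [h]; rfl
    · rw [h]; simp only [back]; rw [if_neg (by omega)]
  rw [hback, Option.or_none]
  have hs : Beats u f (d + 1) b ↔ Beats u f d b ∧ u (f (f^[d] b)) < u b := by
    rw [beats_succ, Function.iterate_succ_apply']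
  split_ifs with h1 h2 h2
  · simp only [onward]
    rw [if_pos ⟨(hs.1 h2.2).2, hd⟩]
  · simp only [onward]
    rw [if_neg fun h => h2 ⟨h1.1, hs.2 ⟨h1.2, h.1⟩⟩]
  · exact absurd ⟨h2.1, (hs.1 h2.2).1⟩ h1
  · rfl

/-- All hop counters have reached `2 ^ k`, so no probe moves on; the ones that beat their receiver
are answered against their direction of travel. -/
theorem Probes.turn {u : Fin n → ℕ} {f g : Fin n → Fin n}
    (hgf : ∀ a, g (f a) = a) {k d : ℕ} {M N N' : Fin n → Option (Msg m)}
    (h : Probes u f k d M) (hN : Probes u g k d N) (hd : d + 1 = 2 ^ k)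
    (hN' : ∀ a, N' a = (onward (u a) (N (f a))).or (back (u a) (M (g a)))) :
    Replies u f k (2 ^ k) N' := by
  intro b
  rw [← hd, hN', Function.iterate_succ_apply', hgf, h b]
  have honw : onward (u (f (f^[d] b))) (N (f (f (f^[d] b)))) = none := by
    rcases hN.eq_none_or hgf (f (f (f^[d] b))) with h | ⟨c, -, -, h⟩
    · rw [h]; rfl
    · rw [h]; simp only [onward]; rw [if_neg (by omega)]
  rw [honw, Option.none_or]
  have hs : Beats u f (d + 1) b ↔ Beats u f d b ∧ u (f (f^[d] b)) < u b := by
    rw [beats_succ, Function.iterate_succ_apply']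
  split_ifs with h1 h2 h2
  · simp only [back]
    rw [if_pos ⟨(hs.1 h2.2).2, by omega⟩]
  · simp only [back]
    rw [if_neg fun h => h2 ⟨h1.1, hs.2 ⟨h1.2, h.1⟩⟩]
  · exact absurd ⟨h2.1, (hs.1 h2.2).1⟩ h1
  · rfl

/-- An agent stops a reply only if the reply is its own. An agent on the way home has a smaller
identifier than the owner of the reply, so it passes the reply on. -/
theorem Replies.forward {u : Fin n → ℕ} {f g : Fin n → Fin n}
    (hgf : ∀ a, g (f a) = a)
    {k d : ℕ} {M N N' : Fin n → Option (Msg m)}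
    (h : Replies u f k (d + 1) N) (hM : Replies u g k (d + 1) M) (h0 : 0 < d) (hd : d < 2 ^ k)
    (hN' : ∀ a, N' a = (onward (u a) (N (f a))).or (back (u a) (M (g a)))) :
    Replies u f k d N' := by
  intro b
  have := h b
  rw [Function.iterate_succ_apply'] at this
  rw [hN', this]
  have hback : back (u (f^[d] b)) (M (g (f^[d] b))) = none := by
    rcases hM.eq_none_or hgf (g (f^[d] b)) with h | ⟨c, -, -, h⟩ <;> rw [h] <;> rfl
  rw [hback, Option.or_none]
  split_ifs with h1
  · have := h1.2 d h0 hd.le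
    simp only [onward]
    rw [if_pos (by omega)]
  · rfl

/-- The agent takes part in the election and has no other progress. -/
structure Electing (s : AgentState m) : Prop where
  mode : s.mode = .elect
  spoken : s.spoken = 0
  assigned : s.assigned = ∅
  mine : s.mine = ∅
  -- With both flags set, an agent would be promoted in a round in which nothing arrives.
  not_both : (s.gotPrev && s.gotNext) = false

/-- The state of agent `b` in phase `k` of the election. -/
structure ElectState (u : Fin n → ℕ) (k : ℕ) (b : Fin n) (s : AgentState m) : Prop
    extends Electing s where
  -- An agent that has dropped out may keep one flag and an old phase number forever; nothing is
  -- claimed about it.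
  candidate : Candidate u k b → s.hsPhase = k ∧ s.gotPrev = false ∧ s.gotNext = false

theorem electAct_relay {i : Input m} {t : ℕ} {s : AgentState m} {x y : Option (Msg m)}
    (ht : t ≠ 0) (hp : ∀ j k d, x = some (.probe j k d) → j ≠ i.id)
    (hl : ∀ j, x ≠ some (.label j))
    (hb : ((s.gotPrev || isOwnReply i.id x) && (s.gotNext || isOwnReply i.id y)) = false) :
    electAct n i t s x y =
      ({ s with gotPrev := s.gotPrev || isOwnReply i.id x,
                gotNext := s.gotNext || isOwnReply i.id y },
        (onward i.id x).or (back i.id y), (onward i.id y).or (back i.id x)) := by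
  rw [electAct, if_neg ht]
  split
  · rename_i j k d
    rw [if_neg (hp j k d rfl)]
    simp only [hb]; rfl
  · rename_i j
    exact absurd rfl (hl j)
  · simp only [hb]; rfl

theorem electAct_promote {i : Input m} {t k k' : ℕ} {s : AgentState m} (ht : t ≠ 0) :
    electAct n i t s (some (.reply i.id k)) (some (.reply i.id k')) =
      ({ s with hsPhase := s.hsPhase + 1, gotPrev := false, gotNext := false },
        some (.probe i.id (s.hsPhase + 1) 1), some (.probe i.id (s.hsPhase + 1) 1)) := by
  rw [electAct, if_neg ht]
  simp [isOwnReply]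

variable (inp : Fin n → Input m) (cost : Msg m → ℝ) (hi : ℝ)

/-- The situation in round `t`, in phase `k` of the election, while probes travel. -/
structure ProbeRound (k d t : ℕ) : Prop where
  state : ∀ b, ElectState (fun a => (inp a).id) k b (((syncBalance n m).run inp t).state b)
  cw : Probes (fun a => (inp a).id) next k d ((syncBalance n m).run inp t).cw
  ccw : Probes (fun a => (inp a).id) prev k d ((syncBalance n m).run inp t).ccw
  cost_le : (syncBalance n m).totalCost inp cost t ≤ 2 * n * hi * t

/-- The situation in round `t`, in phase `k` of the election, while replies travel. -/
structure ReplyRound (k d t : ℕ) : Prop where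
  state : ∀ b, ElectState (fun a => (inp a).id) k b (((syncBalance n m).run inp t).state b)
  -- Replies to the anti-clockwise probes are the ones that travel clockwise.
  cw : Replies (fun a => (inp a).id) prev k d ((syncBalance n m).run inp t).cw
  ccw : Replies (fun a => (inp a).id) next k d ((syncBalance n m).run inp t).ccw
  cost_le : (syncBalance n m).totalCost inp cost t ≤ 2 * n * hi * t

variable {inp cost hi} {lo : ℝ}

/-- Every agent sends at most two messages in a round. This crude count replaces the usual `O(n log
n)` bound on the number of messages of the election; it yields `O(n²)`, which `n ≤ m` absorbs. -/
theorem totalCost_succ_le {t : ℕ}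
    (h : (syncBalance n m).totalCost inp cost t ≤ 2 * n * hi * t)
    (hcw : ∀ a, (((syncBalance n m).run inp (t + 1)).cw a).elim 0 cost ≤ hi)
    (hccw : ∀ a, (((syncBalance n m).run inp (t + 1)).ccw a).elim 0 cost ≤ hi) :
    (syncBalance n m).totalCost inp cost (t + 1) ≤ 2 * n * hi * (t + 1 : ℕ) := by
  have : (syncBalance n m).totalCost inp cost (t + 1) =
      (syncBalance n m).totalCost inp cost t + ∑ a,
      ((((syncBalance n m).run inp (t + 1)).cw a).elim 0 cost +
        (((syncBalance n m).run inp (t + 1)).ccw a).elim 0 cost) := by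
    simp only [RingProtocol.totalCost, Finset.sum_range_succ]
  have h2 : ∑ a, ((((syncBalance n m).run inp (t + 1)).cw a).elim 0 cost +
        (((syncBalance n m).run inp (t + 1)).ccw a).elim 0 cost) ≤ ∑ _a : Fin n, (hi + hi) :=
    Finset.sum_le_sum fun a _ => add_le_add (hcw a) (hccw a)
  rw [Finset.sum_const, Finset.card_univ, Fintype.card_fin, nsmul_eq_mul] at h2
  rw [this]
  push_cast
  linarith

theorem Probes.cost_le (hc : CostBounds inp cost lo hi) {f g : Fin n → Fin n}
    (hfg : ∀ a, f (g a) = a) {k d : ℕ} (hk : k ≤ n) (hd : d + 1 ≤ n)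
    {M : Fin n → Option (Msg m)} (h : Probes (fun a => (inp a).id) f k d M) (a : Fin n) :
    (M a).elim 0 cost ≤ hi := by
  rcases h.eq_none_or hfg a with h | ⟨b, -, -, h⟩
  · rw [h]; exact hc.hi_nonneg
  · rw [h]; exact hc.probe b k _ hk hd

theorem Replies.cost_le (hc : CostBounds inp cost lo hi) {f g : Fin n → Fin n}
    (hfg : ∀ a, f (g a) = a) {k d : ℕ} (hk : k ≤ n)
    {M : Fin n → Option (Msg m)} (h : Replies (fun a => (inp a).id) f k d M) (a : Fin n) :
    (M a).elim 0 cost ≤ hi := by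
  rcases h.eq_none_or hfg a with h | ⟨b, -, -, h⟩
  · rw [h]; exact hc.hi_nonneg
  · rw [h]; exact hc.reply b k hk

theorem ElectState.relay {u : Fin n → ℕ} {k : ℕ} {b : Fin n} {s : AgentState m}
    (h : ElectState u k b s) :
    ElectState u k b { s with gotPrev := s.gotPrev || false, gotNext := s.gotNext || false } := by
  simpa only [Bool.or_false] using h

/-- A round of the election in which no agent receives a reply to its own probe, its own probe, or
a label. -/
theorem run_succ_relay {k t : ℕ} (ht : t ≠ 0)
    (hs : ∀ b, ElectState (fun a => (inp a).id) k b (((syncBalance n m).run inp t).state b))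
    (hp : ∀ a j k d, ((syncBalance n m).run inp t).cw (prev a) = some (.probe j k d) →
      j ≠ (inp a).id)
    (hl : ∀ a j, ((syncBalance n m).run inp t).cw (prev a) ≠ some (.label j))
    (h1 : ∀ a, isOwnReply (inp a).id (((syncBalance n m).run inp t).cw (prev a)) = false)
    (h2 : ∀ a, isOwnReply (inp a).id (((syncBalance n m).run inp t).ccw (next a)) = false) :
    (∀ b, ElectState (fun a => (inp a).id) k b (((syncBalance n m).run inp (t + 1)).state b)) ∧
    (∀ a, ((syncBalance n m).run inp (t + 1)).cw a =
      (onward (inp a).id (((syncBalance n m).run inp t).cw (prev a))).or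
        (back (inp a).id (((syncBalance n m).run inp t).ccw (next a)))) ∧
    (∀ a, ((syncBalance n m).run inp (t + 1)).ccw a =
      (onward (inp a).id (((syncBalance n m).run inp t).ccw (next a))).or
        (back (inp a).id (((syncBalance n m).run inp t).cw (prev a)))) := by
  have key : ∀ a, (syncBalance n m).local_act inp t ((syncBalance n m).run inp t) a = _ :=
    fun a => (act_elect (hs a).mode).trans <| electAct_relay ht (hp a) (hl a)
      (by rw [h1, h2]; simpa using (hs a).not_both)
  simp only [RingProtocol.run, key, h1, h2]
  exact ⟨fun b => (hs b).relay, fun a => trivial, fun a => trivial⟩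


/-- The receiver is `d + 1 < n` steps away from the origin, so it is another agent. -/
theorem ProbeRound.not_own (hinj : Function.Injective fun a => (inp a).id) {k d t : ℕ}
    (hd : d + 1 < n) (h : ProbeRound inp cost hi k d t) (a : Fin n) (j k' d' : ℕ)
    (hx : ((syncBalance n m).run inp t).cw (prev a) = some (.probe j k' d')) :
    j ≠ (inp a).id := by
  rcases h.cw.eq_none_or next_prev (prev a) with h | ⟨b, hb, -, h⟩
  · simp [h] at hx
  · rw [h] at hx
    injection hx with hx
    injection hx with hx
    rintro rfl
    have : b = a := hinj hx
    subst this
    refine iterate_next_ne b d.succ_pos hd ?_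
    rw [Function.iterate_succ_apply', hb, next_prev]

theorem ProbeRound.relay (hinj : Function.Injective fun a => (inp a).id) {k d t : ℕ}
    (hd : d + 1 < n) (ht : t ≠ 0) (h : ProbeRound inp cost hi k d t) :
    (∀ b, ElectState (fun a => (inp a).id) k b (((syncBalance n m).run inp (t + 1)).state b)) ∧
    (∀ a, ((syncBalance n m).run inp (t + 1)).cw a =
      (onward (inp a).id (((syncBalance n m).run inp t).cw (prev a))).or
        (back (inp a).id (((syncBalance n m).run inp t).ccw (next a)))) ∧
    (∀ a, ((syncBalance n m).run inp (t + 1)).ccw a =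
      (onward (inp a).id (((syncBalance n m).run inp t).ccw (next a))).or
        (back (inp a).id (((syncBalance n m).run inp t).cw (prev a)))) := by
  refine run_succ_relay ht h.state (h.not_own hinj hd) ?_ ?_ ?_ <;> intro a
  · intro j
    rcases h.cw.eq_none_or next_prev (prev a) with h | ⟨b, -, -, h⟩ <;> simp [h]
  · rcases h.cw.eq_none_or next_prev (prev a) with h | ⟨b, -, -, h⟩ <;> simp [h, isOwnReply]
  · rcases h.ccw.eq_none_or prev_next (next a) with h | ⟨b, -, -, h⟩ <;> simp [h, isOwnReply]

theorem ProbeRound.succ (hinj : Function.Injective fun a => (inp a).id)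
    (hc : CostBounds inp cost lo hi) {k d t : ℕ} (hk : k ≤ n)
    (hd : d + 1 < n) (hdk : d + 1 < 2 ^ k) (ht : t ≠ 0) (h : ProbeRound inp cost hi k d t) :
    ProbeRound inp cost hi k (d + 1) (t + 1) := by
  obtain ⟨h1, h2, h3⟩ := h.relay hinj hd ht
  have hcw := h.cw.forward prev_next h.ccw hdk h2
  have hccw := h.ccw.forward next_prev h.cw hdk h3
  exact ⟨h1, hcw, hccw, totalCost_succ_le h.cost_le (hcw.cost_le hc next_prev hk hd)
    (hccw.cost_le hc prev_next hk hd)⟩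

theorem ProbeRound.turn (hinj : Function.Injective fun a => (inp a).id)
    (hc : CostBounds inp cost lo hi) {k d t : ℕ} (hk : k ≤ n)
    (hd : d + 1 < n) (hdk : d + 1 = 2 ^ k) (ht : t ≠ 0) (h : ProbeRound inp cost hi k d t) :
    ReplyRound inp cost hi k (2 ^ k) (t + 1) := by
  obtain ⟨h1, h2, h3⟩ := h.relay hinj hd ht
  have hccw := h.cw.turn prev_next h.ccw hdk h3
  have hcw := h.ccw.turn next_prev h.cw hdk h2
  exact ⟨h1, hcw, hccw, totalCost_succ_le h.cost_le (hcw.cost_le hc prev_next hk)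
    (hccw.cost_le hc next_prev hk)⟩

theorem ReplyRound.succ (hc : CostBounds inp cost lo hi) {k d t : ℕ} (hk : k ≤ n)
    (h0 : 0 < d) (hd : d < 2 ^ k) (ht : t ≠ 0) (h : ReplyRound inp cost hi k (d + 1) t) :
    ReplyRound inp cost hi k d (t + 1) := by
  -- The receiver is still `d > 0` steps away from the owner of the reply, and the owner has beaten
  -- it, so their identifiers differ.
  have own : ∀ {f g : Fin n → Fin n} (_ : ∀ a, g (f a) = a) (_ : ∀ a, f (g a) = a)
      {M : Fin n → Option (Msg m)} (_ : Replies (fun a => (inp a).id) f k (d + 1) M) (a : Fin n),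
      isOwnReply (inp a).id (M (f a)) = false := by
    intro f g hgf hfg M hM a
    rcases hM.eq_none_or hfg (f a) with h | ⟨b, hb, hb', h⟩
    · rw [h]; rfl
    · rw [h]
      rw [Function.iterate_succ_apply'] at hb
      have : f^[d] b = a := by rw [← hgf (f^[d] b), hb, hgf]
      have := hb' d h0 hd.le
      simp only at this
      simp only [isOwnReply, decide_eq_false_iff_not]
      subst a
      omega
  obtain ⟨h1, h2, h3⟩ := run_succ_relay ht h.state
    (fun a j k d => by
      rcases h.cw.eq_none_or prev_next (prev a) with h | ⟨b, -, -, h⟩ <;> simp [h])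
    (fun a j => by
      rcases h.cw.eq_none_or prev_next (prev a) with h | ⟨b, -, -, h⟩ <;> simp [h])
    (own next_prev prev_next h.cw) (own prev_next next_prev h.ccw)
  have hccw := h.ccw.forward prev_next h.cw h0 hd h3
  have hcw := h.cw.forward next_prev h.ccw h0 hd h2
  exact ⟨h1, hcw, hccw, totalCost_succ_le h.cost_le (hcw.cost_le hc prev_next hk)
    (hccw.cost_le hc next_prev hk)⟩

/-- Replies from both sides reach their owner in the same round. By `candidate_succ`, getting both
means being a candidate of phase `k + 1`. An agent that gets only one sets one flag and has dropped
out. -/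
theorem ReplyRound.promote (hc : CostBounds inp cost lo hi) {k t : ℕ} (hk : k + 1 ≤ n)
    (ht : t ≠ 0) (h : ReplyRound inp cost hi k 1 t) :
    ProbeRound inp cost hi (k + 1) 0 (t + 1) := by
  classical
  have key : ∀ b, ∃ s, (syncBalance n m).local_act inp t ((syncBalance n m).run inp t) b =
      (s, if Candidate (fun a => (inp a).id) (k + 1) b
            then some (.probe (inp b).id (k + 1) 1) else none,
        if Candidate (fun a => (inp a).id) (k + 1) b
            then some (.probe (inp b).id (k + 1) 1) else none) ∧
      ElectState (fun a => (inp a).id) (k + 1) b s := by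
    intro b
    have hs := h.state b
    have hx := h.cw b
    have hy := h.ccw b
    simp only [Function.iterate_one] at hx hy
    simp only [RingProtocol.local_act]
    rw [act_elect hs.mode, hx, hy, candidate_succ]
    by_cases hp : Candidate (fun a => (inp a).id) k b ∧ Beats (fun a => (inp a).id) prev (2 ^ k) b
      <;> by_cases hq : Candidate (fun a => (inp a).id) k b ∧
        Beats (fun a => (inp a).id) next (2 ^ k) b
    · rw [if_pos hp, if_pos hq, if_pos ⟨hq, hp⟩, electAct_promote ht]
      refine ⟨_, Prod.ext rfl (by rw [(hs.candidate hp.1).1]),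
        ⟨hs.mode, hs.spoken, hs.assigned, hs.mine, rfl⟩,
        fun _ => ⟨?_, rfl, rfl⟩⟩
      exact congrArg (· + 1) (hs.candidate hp.1).1
    · obtain ⟨-, hgp, hgn⟩ := hs.candidate hp.1
      rw [if_pos hp, if_neg hq, if_neg fun h => hq h.1, electAct_relay ht (by simp) (by simp)
        (by simp [hgn, isOwnReply])]
      refine ⟨_, Prod.ext rfl (by simp [onward, back]),
        ⟨hs.mode, hs.spoken, hs.assigned, hs.mine, ?_⟩,
        fun h => absurd (candidate_succ.1 h).1 hq⟩
      simp [hgn, isOwnReply]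
    · obtain ⟨-, hgp, hgn⟩ := hs.candidate hq.1
      rw [if_neg hp, if_pos hq, if_neg fun h => hp h.2, electAct_relay ht (by simp) (by simp)
        (by simp [hgp, isOwnReply])]
      refine ⟨_, Prod.ext rfl (by simp [onward, back]),
        ⟨hs.mode, hs.spoken, hs.assigned, hs.mine, ?_⟩,
        fun h => absurd (candidate_succ.1 h).2 hp⟩
      simp [hgp, isOwnReply]
    · rw [if_neg hp, if_neg hq, if_neg fun h => hp h.2, electAct_relay ht (by simp) (by simp)
        (by simpa [isOwnReply] using hs.not_both)]
      refine ⟨_, Prod.ext rfl (by simp [onward, back]),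
        ⟨hs.mode, hs.spoken, hs.assigned, hs.mine, ?_⟩,
        fun h => absurd (candidate_succ.1 h).2 hp⟩
      simpa [isOwnReply] using hs.not_both
  choose s hs hs' using key
  have beats0 : ∀ f b, Beats (fun a => (inp a).id) f 0 b := fun f b i h0 hi => by omega
  have hcw : Probes (fun a => (inp a).id) next (k + 1) 0
      ((syncBalance n m).run inp (t + 1)).cw := by
    intro b
    simp only [RingProtocol.run, hs, Function.iterate_zero_apply, beats0, and_true, Nat.zero_add]
  have hccw : Probes (fun a => (inp a).id) prev (k + 1) 0
      ((syncBalance n m).run inp (t + 1)).ccw := by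
    intro b
    simp only [RingProtocol.run, hs, Function.iterate_zero_apply, beats0, and_true, Nat.zero_add]
  refine ⟨fun b => ?_, hcw, hccw, totalCost_succ_le h.cost_le (hcw.cost_le hc next_prev hk ?_)
    (hccw.cost_le hc prev_next hk ?_)⟩
  · simp only [RingProtocol.run, hs]
    exact hs' b
  all_goals omega

theorem probeRound_zero (hn : 0 < n) (hc : CostBounds inp cost lo hi) :
    ProbeRound inp cost hi 0 0 1 := by
  have cand : ∀ f d b, d = 0 → Beats (fun a => (inp a).id) f d b := fun f d b hd i h0 hi => by omega
  have key : ∀ a, (syncBalance n m).local_act inp 0 ((syncBalance n m).run inp 0) a =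
      (initState, some (.probe (inp a).id 0 1), some (.probe (inp a).id 0 1)) := fun a => rfl
  have hcw : Probes (fun a => (inp a).id) next 0 0 ((syncBalance n m).run inp (0 + 1)).cw := by
    intro b
    rw [if_pos ⟨⟨cand _ _ _ rfl, cand _ _ _ rfl⟩, cand _ _ _ rfl⟩]
    rfl
  have hccw : Probes (fun a => (inp a).id) prev 0 0 ((syncBalance n m).run inp (0 + 1)).ccw := by
    intro b
    rw [if_pos ⟨⟨cand _ _ _ rfl, cand _ _ _ rfl⟩, cand _ _ _ rfl⟩]
    rfl
  refine ⟨fun b => ⟨⟨rfl, rfl, rfl, rfl, rfl⟩, fun _ => ⟨rfl, rfl, rfl⟩⟩, hcw, hccw, ?_⟩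
  exact totalCost_succ_le (by simp [RingProtocol.totalCost])
    (hcw.cost_le hc next_prev (Nat.zero_le _) hn) (hccw.cost_le hc prev_next (Nat.zero_le _) hn)

theorem ProbeRound.add (hinj : Function.Injective fun a => (inp a).id)
    (hc : CostBounds inp cost lo hi) {k t : ℕ} (hk : k ≤ n) (ht : t ≠ 0)
    (h : ProbeRound inp cost hi k 0 t) (d : ℕ) (hd : d < n) (hdk : d < 2 ^ k) :
    ProbeRound inp cost hi k d (t + d) := by
  induction d with
  | zero => exact h
  | succ d ih =>
    have := (ih (by omega) (by omega)).succ hinj hc hk hd hdk (by omega)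
    exact this

theorem ReplyRound.add (hc : CostBounds inp cost lo hi) {k t : ℕ} (hk : k ≤ n) (ht : t ≠ 0)
    (h : ReplyRound inp cost hi k (2 ^ k) t) (d : ℕ) (hdk : d < 2 ^ k) :
    ReplyRound inp cost hi k (2 ^ k - d) (t + d) := by
  induction d with
  | zero => exact h
  | succ d ih =>
    have := ih (by omega)
    rw [(by omega : 2 ^ k - d = (2 ^ k - (d + 1)) + 1)] at this
    have := this.succ hc hk (by omega) (by omega) (by omega)
    exact this

/-- Phase `k` of the election begins in round `2 ^ (k + 1) - 2`. -/
theorem probeRound_phase (hinj : Function.Injective fun a => (inp a).id) (hn : 0 < n)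
    (hc : CostBounds inp cost lo hi) (k : ℕ) (hk : ∀ k' < k, 2 ^ k' < n) :
    ProbeRound inp cost hi k 0 (2 ^ (k + 1) - 1) := by
  induction k with
  | zero => exact probeRound_zero hn hc
  | succ k ih =>
    have h2 := hk k (by omega)
    have hkn : k < n := k.lt_two_pow_self.trans h2
    have hpos : 0 < 2 ^ k := by positivity
    have e1 : 2 ^ (k + 1) = 2 * 2 ^ k := by ring
    have e2 : 2 ^ (k + 1 + 1) = 4 * 2 ^ k := by ring
    -- From the round after the probes are sent: `2 ^ k - 1` rounds of travel, one to turn, `2 ^ k -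
    -- 1` of travel back, one to promote. So phase `k` lasts `2 ^ (k + 1)` rounds.
    have h := (ih fun k' hk' => hk k' (by omega)).add hinj hc hkn.le (by omega)
      (2 ^ k - 1) (by omega) (by omega)
    have := ((h.turn hinj hc hkn.le (by omega) (by omega) (by omega)).add hc hkn.le
      (by omega) (2 ^ k - 1) (by omega))
    rw [(by omega : 2 ^ k - (2 ^ k - 1) = 1)] at this
    have := this.promote hc hkn (by omega)
    convert this using 1
    omega

end Election

/-! ### The leader and the labels. -/

section Labelling

variable {n m : ℕ} {inp : Fin n → Input m} {cost : Msg m → ℝ} {lo hi : ℝ}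

theorem beats_leader_iff {u : Fin n → ℕ} (hinj : Function.Injective u) {L : Fin n}
    (hL : ∀ a, u a ≤ u L) (b : Fin n) : Beats u next (n - 1) b ↔ b = L := by
  constructor
  · intro h
    by_contra hb
    have h0 : dist b L ≠ 0 := fun h0 => hb <| by
      rw [← iterate_next_dist b L, h0]; rfl
    have := h (dist b L) (by omega) (by have := dist_lt b L; omega)
    rw [iterate_next_dist] at this
    exact absurd this (not_lt.2 (hL b))
  · rintro rfl i h0 hi
    exact lt_of_le_of_ne (hL _) fun h => iterate_next_ne b h0 (by omega) (hinj h)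

theorem candidate_leader {u : Fin n → ℕ} (hinj : Function.Injective u) {L : Fin n}
    (hL : ∀ a, u a ≤ u L) {k : ℕ} (hk : 2 ^ k / 2 < n) : Candidate u k L :=
  ⟨fun _ h0 hi => lt_of_le_of_ne (hL _) fun h => iterate_next_ne L h0 (by omega) (hinj h),
    fun _ h0 hi => lt_of_le_of_ne (hL _) fun h => iterate_prev_ne L h0 (by omega) (hinj h)⟩

theorem electAct_idle {i : Input m} {t : ℕ} {s : AgentState m} (ht : t ≠ 0) (h : Electing s) :
    electAct n i t s none none = (s, none, none) := by
  rw [electAct_relay ht (by simp) (by simp) (by simpa [isOwnReply] using h.not_both)]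
  simp [onward, back, isOwnReply]

theorem electAct_leader {i : Input m} {t k d : ℕ} {s : AgentState m} {y : Option (Msg m)}
    (ht : t ≠ 0) : electAct n i t s (some (.probe i.id k d)) y =
      ({ s with label := 0, mode := .estimate (t + n) 0 }, some (.label 1), none) := by
  simp [electAct, ht]

/-- The agent with the largest identifier becomes the leader. -/
theorem exists_leader (hn : 2 ≤ n) (hinj : Function.Injective fun a => (inp a).id)
    (hc : CostBounds inp cost lo hi) :
    ∃ (L : Fin n) (t : ℕ) (s : Fin n → AgentState m), t ≠ 0 ∧ t ≤ 5 * n ∧ (∀ a, Electing (s a)) ∧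
      (syncBalance n m).run inp (t + 1) =
        ⟨front L s (fun a => { s a with label := dist L a, mode := .estimate (t + n) 0 }) 1,
          toward (next L) (some (.label 1)), fun _ => none⟩ ∧
      (syncBalance n m).totalCost inp cost (t + 1) ≤ 2 * n * hi * (t + 1 : ℕ) := by
  have : Nonempty (Fin n) := ⟨⟨0, by omega⟩⟩
  obtain ⟨L, hL⟩ := Finite.exists_max fun a => (inp a).id
  have hK0 : 0 < Nat.clog 2 n := Nat.clog_pos (by omega) hn
  -- `Nat.clog 2 n` is the first phase whose probes may travel `n` hops. In all earlier phases no
  -- agent can meet its own probe.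
  have hlt : ∀ k' < Nat.clog 2 n, 2 ^ k' < n := fun k' h => Nat.pow_lt_of_lt_clog h
  have hle : n ≤ 2 ^ Nat.clog 2 n := Nat.le_pow_clog (by omega) n
  obtain ⟨K, hK⟩ : ∃ K, Nat.clog 2 n = K + 1 := ⟨_, (Nat.succ_pred_eq_of_pos hK0).symm⟩
  rw [hK] at hlt hle
  have hKn : 2 ^ K < n := hlt K (by omega)
  have hK1 : K < n := K.lt_two_pow_self.trans hKn
  have e1 : 2 ^ (K + 1) = 2 * 2 ^ K := by ring
  have e2 : 2 ^ (K + 1 + 1) = 4 * 2 ^ K := by ring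
  have hpos : 0 < 2 ^ K := by positivity
  have h := (probeRound_phase hinj (by omega) hc (K + 1) hlt).add hinj hc hK1 (by omega)
    (n - 1) (by omega) (by omega)
  -- As `2 ^ K < n`, this is less than `4 n + n`.
  set t := 2 ^ (K + 1 + 1) - 1 + (n - 1) with ht
  have ht0 : t ≠ 0 := by omega
  have hcand := candidate_leader hinj hL (k := K + 1) (by omega)
  -- What arrives at `b` now can only be its own probe, which is alive only if `b` beats all other
  -- agents.
  have hprev : ∀ b, ((syncBalance n m).run inp t).cw (prev b) =
      if b = L then some (.probe (inp b).id (K + 1) n) else none := by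
    intro b
    rw [prev_eq_iterate_next, h.cw b]
    by_cases hb : b = L
    · rw [if_pos hb, if_pos ⟨hb ▸ hcand, (beats_leader_iff hinj hL b).2 hb⟩]
      simp only [Nat.sub_add_cancel (by omega : 1 ≤ n)]
    · rw [if_neg hb, if_neg fun h => hb ((beats_leader_iff hinj hL b).1 h.2)]
  -- Anti-clockwise probes of other agents would have had to pass `L`. The one of `L` comes home in
  -- this very round and is ignored.
  have hnext : ∀ b, b ≠ L → ((syncBalance n m).run inp t).ccw (next b) = none := by
    intro b hb
    rw [next_eq_iterate_prev, h.ccw b, if_neg]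
    rintro ⟨-, hbe⟩
    have hd : dist L b ≠ 0 := fun h0 => hb <| by
      rw [← iterate_next_dist L b, h0]; rfl
    have := hbe (dist L b) (by omega) (by have := dist_lt L b; omega)
    have hpb := iterate_prev_next L (dist L b)
    rw [iterate_next_dist] at hpb
    rw [hpb] at this
    exact absurd this (not_lt.2 (hL b))
  have key : ∀ b, (syncBalance n m).local_act inp t ((syncBalance n m).run inp t) b =
      (front L ((syncBalance n m).run inp t).state (fun a =>
        { ((syncBalance n m).run inp t).state a with
            label := dist L a, mode := .estimate (t + n) 0 }) 1 b,
        toward (next L) (some (.label 1)) b, none) := by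
    intro b
    simp only [RingProtocol.local_act]
    rw [act_elect (h.state b).mode, hprev]
    by_cases hb : b = L
    · subst hb
      rw [if_pos rfl, electAct_leader ht0]
      simp [front, dist_self, toward]
    · rw [if_neg hb, hnext b hb, electAct_idle ht0 (h.state b).toElecting]
      have hd : dist L b ≠ 0 := fun h0 => hb <| by
        rw [← iterate_next_dist L b, h0]; rfl
      have : next b ≠ next L := fun h => hb (next_injective h)
      simp [front, toward, hd, this]
  have hrun : (syncBalance n m).run inp (t + 1) =
        ⟨front L ((syncBalance n m).run inp t).state (fun a =>
          { ((syncBalance n m).run inp t).state a with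
            label := dist L a, mode := .estimate (t + n) 0 }) 1,
          toward (next L) (some (.label 1)), fun _ => none⟩ := by
    simp only [RingProtocol.run, key]
  refine ⟨L, t, ((syncBalance n m).run inp t).state, ht0, by omega,
    fun a => (h.state a).toElecting, hrun, ?_⟩
  refine totalCost_succ_le h.cost_le (fun a => ?_) (fun a => ?_)
  · rw [hrun]
    simp only [toward]
    split_ifs
    · exact hc.label 1 (by omega)
    · exact hc.hi_nonneg
  · rw [hrun]
    exact hc.hi_nonneg

theorem estimateAct_wait {i : Input m} {t S r : ℕ} {s : AgentState m} {x : Option (Msg m)}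
    (h : t < S + s.label) : estimateAct n i t s S r x = (s, none, none) := by
  rw [estimateAct, if_neg (by omega)]

/-- Phase 1 takes `O(n)` rounds and elects a leader `L`; all agents know their distance from it. -/
theorem phase_one (hn : 2 ≤ n) (hinj : Function.Injective fun a => (inp a).id)
    (hc : CostBounds inp cost lo hi) :
    ∃ (L : Fin n) (E : ℕ) (s : Fin n → AgentState m), E ≤ 6 * n ∧
      (syncBalance n m).run inp E = ⟨s, toward L none, fun _ => none⟩ ∧
      (∀ a, (s a).mode = .estimate E 0 ∧ (s a).label = dist L a ∧ (s a).spoken = 0 ∧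
        (s a).assigned = ∅ ∧ (s a).mine = ∅) ∧
      (syncBalance n m).totalCost inp cost E ≤ 2 * n * hi * E := by
  obtain ⟨L, t, s, ht0, ht, hs, hrun, hcost⟩ := exists_leader hn hinj hc
  -- The leader has already acted, so the wave of labels starts at distance `1`.
  obtain ⟨h1, h2⟩ := sweep inp cost L t 1 n (by omega) le_rfl s
    (fun a => { s a with label := dist L a, mode := .estimate (t + n) 0 })
    (fun i => if i < n then some (.label i) else none)
    (fun a t' h1 _ _ => by
      rw [act_elect (hs a).mode, electAct_idle (by omega) (hs a)])
    (fun a h1 h2 => by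
      have : dist L a < n := h2
      rw [act_elect (hs a).mode, if_pos this]
      simp only [electAct]
      rw [if_neg (by omega), (by omega : t + dist L a + (n - dist L a) = t + n)])
    (fun a t' h1 h2 h3 => by
      have := dist_lt L a
      rw [act_estimate rfl, estimateAct_wait (by simp only; omega)])
    (by rw [if_pos (by omega)]; exact hrun)
  rw [front_card, iterate_next_card, if_neg (lt_irrefl n)] at h1
  refine ⟨L, t + n, _, by omega, h1, fun a => ⟨rfl, rfl, (hs a).spoken, (hs a).assigned,
    (hs a).mine⟩, ?_⟩
  rw [h2]
  have hsum : ∑ i ∈ Finset.Ico 1 n, ((if i + 1 < n then some (Msg.label (i + 1)) else none :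
      Option (Msg m)).elim 0 cost) ≤ ∑ _i ∈ Finset.Ico 1 n, hi := by
    refine Finset.sum_le_sum fun i _ => ?_
    split_ifs with h
    · exact hc.label _ h.le
    · exact hc.hi_nonneg
  rw [Finset.sum_const, Nat.card_Ico, nsmul_eq_mul] at hsum
  push_cast [Nat.cast_sub (by omega : 1 ≤ n)] at hsum hcost ⊢
  have h0 := hc.hi_nonneg
  have hn' : (2 : ℝ) ≤ n := by exact_mod_cast hn
  have h1 := mul_nonneg h0 (by linarith : (0 : ℝ) ≤ (n : ℝ) - 2)
  nlinarith [mul_nonneg h1 (by linarith : (0 : ℝ) ≤ n)]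

end Labelling

/-! ### Phase 2: estimating the largest number of items. -/

section Estimate

variable {n m : ℕ} {inp : Fin n → Input m} {cost : Msg m → ℝ} {lo hi : ℝ}

/-- The stage of Phase 2 in which the agent speaks up. -/
def level (i : Input m) : ℕ := Nat.log 2 (Finset.univ.sup i.weight)

/-- The convention `Nat.log 2 0 = 0` matches the rule that an agent without items speaks up in stage
`0`. Hence every agent speaks up exactly once. -/
theorem speaksUp_eq (i : Input m) (r : ℕ) : speaksUp i r = if level i = r then 1 else 0 := by
  have h : ((Finset.univ.sup i.weight = 0 ∧ r = 0) ∨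
      (2 ^ r ≤ Finset.univ.sup i.weight ∧ Finset.univ.sup i.weight < 2 ^ (r + 1))) ↔
      level i = r := by
    rw [level]
    generalize Finset.univ.sup i.weight = p
    rcases Nat.eq_zero_or_pos p with rfl | hp
    · have : 0 < 2 ^ r := by positivity
      rw [Nat.log_zero_right]
      constructor
      · rintro (⟨-, h⟩ | ⟨h, -⟩) <;> omega
      · exact fun h => Or.inl ⟨rfl, h.symm⟩
    · rw [Nat.log_eq_iff (Or.inr ⟨by norm_num, by omega⟩)]
      omega
  simp only [speaksUp, h]

theorem step1Act_wait {i : Input m} {t S r : ℕ} {s : AgentState m} {x : Option (Msg m)}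
    (h : t < S + s.label) : step1Act n i t s S r x = (s, none, none) := by
  simp only [step1Act]
  rw [if_neg (by omega), if_neg (by omega)]

theorem step2Act_wait {i : Input m} {t S r : ℕ} {s : AgentState m} {x : Option (Msg m)}
    (h : t < S + s.label) : step2Act n i t s S r x = (s, none, none) := by
  simp only [step2Act]
  rw [if_neg (by omega), if_neg (by omega)]

/-- The number of agents that speak up before stage `r` of Phase 2. -/
def spokenBefore (inp : Fin n → Input m) (r : ℕ) : ℕ :=
  (Finset.univ.filter fun a => level (inp a) < r).card

theorem spokenBefore_succ (r : ℕ) :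
    spokenBefore inp (r + 1) = spokenBefore inp r + ∑ a, speaksUp (inp a) r := by
  simp only [spokenBefore, speaksUp_eq, Finset.card_filter, ← Finset.sum_add_distrib]
  refine Finset.sum_congr rfl fun a _ => ?_
  split_ifs <;> omega

theorem spokenBefore_le (r : ℕ) : spokenBefore inp r ≤ n := by
  simpa [spokenBefore] using
    Finset.card_filter_le (Finset.univ : Finset (Fin n)) fun a => level (inp a) < r

/-- The largest number of items of one color that an agent holds. -/
def maxWeight (inp : Fin n → Input m) : ℕ :=
  Finset.univ.sup fun a => Finset.univ.sup (inp a).weight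

/-- The agent that holds the maximum is among the last to speak up, since `Nat.log` is monotone.
This identifies the stage in which the test of the leader succeeds. -/
theorem le_spokenBefore_iff {r : ℕ} (hn : 0 < n) :
    n ≤ spokenBefore inp r ↔ Nat.log 2 (maxWeight inp) < r := by
  have h1 : n ≤ spokenBefore inp r ↔ ∀ a, level (inp a) < r := by
    constructor
    · intro h a
      have hc : (Finset.univ.filter fun a => level (inp a) < r) = Finset.univ := by
        apply Finset.eq_univ_of_card
        rw [Fintype.card_fin]
        exact le_antisymm (spokenBefore_le r) h
      have ha := Finset.mem_univ a
      rw [← hc] at ha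
      exact (Finset.mem_filter.1 ha).2
    · intro h
      simp [spokenBefore, h]
  rw [h1]
  have hne : (Finset.univ : Finset (Fin n)).Nonempty := ⟨⟨0, hn⟩, Finset.mem_univ _⟩
  constructor
  · intro h
    obtain ⟨a, -, ha⟩ := Finset.exists_mem_eq_sup _ hne fun a => Finset.univ.sup (inp a).weight
    rw [maxWeight, ha]
    exact h a
  · intro h a
    exact (Nat.log_mono_right (Finset.le_sup (f := fun a => Finset.univ.sup (inp a).weight)
      (Finset.mem_univ a))).trans_lt h

/-- The configuration at the beginning of stage `r` of Phase 2, in round `S`. -/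
structure EstimateStage (inp : Fin n → Input m) (L : Fin n) (r S : ℕ) (s : Fin n → AgentState m)
    (x : Option (Msg m)) : Prop where
  run : (syncBalance n m).run inp S = ⟨s, toward L x, fun _ => none⟩
  mode : ∀ a, (s a).mode = .estimate S r
  label : ∀ a, (s a).label = dist L a
  assigned : ∀ a, (s a).assigned = ∅
  mine : ∀ a, (s a).mine = ∅
  -- The total stored by the leader is one stage behind; the result of the last stage is just
  -- arriving.
  spoken : (s L).spoken + countOf x = spokenBefore inp r

/-- The number of agents among the first `i` that speak up in stage `r`. -/
def countUpTo (inp : Fin n → Input m) (L : Fin n) (r i : ℕ) : ℕ :=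
  ∑ j ∈ Finset.range i, speaksUp (inp (next^[j] L)) r

theorem countUpTo_succ (L : Fin n) (r : ℕ) (a : Fin n) :
    countUpTo inp L r (dist L a + 1) = countUpTo inp L r (dist L a) + speaksUp (inp a) r := by
  rw [countUpTo, Finset.sum_range_succ, iterate_next_dist, countUpTo]

theorem countUpTo_card (L : Fin n) (r : ℕ) :
    countUpTo inp L r n = ∑ a, speaksUp (inp a) r := by
  rw [countUpTo, ← sum_dist L]
  simp only [iterate_next_dist]

theorem countUpTo_mono (L : Fin n) (r : ℕ) {i j : ℕ} (h : i ≤ j) :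
    countUpTo inp L r i ≤ countUpTo inp L r j :=
  Finset.sum_le_sum_of_subset (Finset.range_mono h)

/-- The message with the number `c`, which is not sent if `c = 0`. -/
def countMsg (c : ℕ) : Option (Msg m) := if 0 < c then some (.count c) else none

theorem countOf_countMsg (c : ℕ) : countOf (countMsg c : Option (Msg m)) = c := by
  unfold countMsg
  split_ifs with h
  · rfl
  · simp only [countOf]; omega

theorem countMsg_ne_finish (c : ℕ) : (countMsg c : Option (Msg m)) ≠ some .finish := by
  unfold countMsg
  split_ifs <;> simp

/-- At most `n` counts are sent, and none if nobody speaks up, so the cost is at most `hi * n` per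
new speaker. In this form the bounds telescope over the stages. -/
theorem EstimateStage.succ (hc : CostBounds inp cost lo hi) {L : Fin n} {r S : ℕ}
    {s : Fin n → AgentState m} {x : Option (Msg m)} (h : EstimateStage inp L r S s x)
    (hr : r ≤ Nat.log 2 (maxWeight inp)) :
    ∃ s' x', EstimateStage inp L (r + 1) (S + n) s' x' ∧
      (syncBalance n m).totalCost inp cost (S + n) ≤ (syncBalance n m).totalCost inp cost S +
        hi * n * (spokenBefore inp (r + 1) - spokenBefore inp r) := by
  have hlt : spokenBefore inp r < n :=
    not_le.1 fun h => absurd ((le_spokenBefore_iff L.pos).1 h) (not_lt.2 hr)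
  obtain ⟨h1, h2⟩ := full_sweep inp cost L S s
    (fun a => { s a with
      spoken := if dist L a = 0 then spokenBefore inp r else (s a).spoken
      mode := .estimate (S + n) (r + 1) })
    -- The message `x` that the leader receives belongs to the previous stage and does not enter the
    -- new count.
    (fun i => if i = 0 then x else countMsg (countUpTo inp L r i))
    (fun a t _ ht => by
      rw [act_estimate (h.mode a), estimateAct_wait (by rw [h.label]; exact ht)])
    (fun a => by
      rw [act_estimate (h.mode a), estimateAct, h.label, if_pos rfl,
        if_neg (Nat.succ_ne_zero _), countUpTo_succ]
      by_cases ha : dist L a = 0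
      · have hL : a = L := dist_injective L (ha.trans (dist_self L).symm)
        have h0 : countUpTo inp L r 0 = 0 := rfl
        simp only [if_pos ha]
        rw [← h.spoken] at hlt
        rw [hL, if_neg (not_le.2 hlt), h.spoken, dist_self, h0, Nat.zero_add]
        simp only [h.label, dist_self]
        rfl
      · simp only [if_neg ha]
        rw [if_neg (countMsg_ne_finish _), countOf_countMsg, ← h.label a]
        rfl)
    (fun a t _ ht => by
      rw [act_estimate rfl, estimateAct_wait (by simp only; omega)])
    h.run
  have hn := L.pos
  rw [if_neg hn.ne', countUpTo_card] at h1
  refine ⟨_, _, ⟨h1, fun a => rfl, h.label, h.assigned, h.mine, ?_⟩, ?_⟩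
  · simp only [dist_self, if_true]
    rw [countOf_countMsg, spokenBefore_succ]
  · rw [h2, spokenBefore_succ, ← countUpTo_card L]
    have hterm : ∀ i ∈ Finset.range n, ((if i + 1 = 0 then x
        else countMsg (countUpTo inp L r (i + 1))).elim 0 cost) ≤ hi * countUpTo inp L r n := by
      intro i hi'
      rw [if_neg (Nat.succ_ne_zero _), countMsg]
      have hmono := countUpTo_mono (inp := inp) L r (Nat.succ_le_of_lt (Finset.mem_range.1 hi'))
      have hle : countUpTo inp L r n ≤ n := by
        have := spokenBefore_le (inp := inp) (r + 1)
        rw [spokenBefore_succ, ← countUpTo_card L] at this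
        omega
      split_ifs with hp
      · refine (hc.count _ (hmono.trans hle)).trans (le_mul_of_one_le_right hc.hi_nonneg ?_)
        exact_mod_cast hp.trans_le hmono
      · exact mul_nonneg hc.hi_nonneg (Nat.cast_nonneg _)
    have := Finset.sum_le_sum hterm
    rw [Finset.sum_const, Finset.card_range, nsmul_eq_mul] at this
    rw [Nat.cast_add]
    linarith

theorem EstimateStage.finish (hc : CostBounds inp cost lo hi) {L : Fin n} {r S : ℕ}
    {s : Fin n → AgentState m} {x : Option (Msg m)} (h : EstimateStage inp L (r + 1) S s x)
    (hr : Nat.log 2 (maxWeight inp) = r) :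
    ∃ s', (syncBalance n m).run inp (S + n + 1) = ⟨s', toward L none, fun _ => none⟩ ∧
      (∀ a, (s' a).mode = .step1 (S + n + 1) 0 ∧ (s' a).label = dist L a ∧
        (s' a).pUB = 2 ^ (r + 1) ∧ (s' a).assigned = ∅ ∧ (s' a).mine = ∅) ∧
      (syncBalance n m).totalCost inp cost (S + n + 1) ≤
        (syncBalance n m).totalCost inp cost S + hi * n := by
  have hle : n ≤ spokenBefore inp (r + 1) := (le_spokenBefore_iff L.pos).2 (by omega)
  obtain ⟨h1, h2⟩ := full_sweep inp cost L S s
    (fun a => { s a with pUB := 2 ^ (r + 1), mode := .step1 (S + n + 1) 0 })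
    (fun i => if i = 0 then x else some .finish)
    (fun a t _ ht => by
      rw [act_estimate (h.mode a), estimateAct_wait (by rw [h.label]; exact ht)])
    (fun a => by
      have hlt := dist_lt L a
      rw [act_estimate (h.mode a), estimateAct, h.label, if_pos rfl,
        if_neg (Nat.succ_ne_zero _),
        (by omega : S + dist L a + (n - dist L a + 1) = S + n + 1), Nat.add_sub_cancel]
      by_cases ha : dist L a = 0
      · have hL : a = L := dist_injective L (ha.trans (dist_self L).symm)
        simp only [if_pos ha]
        rw [← h.spoken] at hle
        rw [hL, if_pos hle, ← h.label L]
      · simp only [if_neg ha, if_true, h.label a])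
    (fun a t _ ht => by
      rw [act_step1 rfl, step1Act_wait (by simp only; omega)])
    h.run
  have hn := L.pos
  rw [if_neg hn.ne'] at h1
  -- The end marker returns to the leader in round `S + n`, one round before Phase 3 begins, and is
  -- ignored.
  have h3 := run_succ_eq inp (w' := toward L none) h1
    (st' := fun a => { s a with pUB := 2 ^ (r + 1), mode := .step1 (S + n + 1) 0 }) (fun a => by
      rw [act_step1 rfl, step1Act_wait (by simp only; omega), toward_none])
  refine ⟨_, h3, fun a => ⟨rfl, h.label a, rfl, h.assigned a, h.mine a⟩, ?_⟩
  rw [totalCost_succ inp cost h3, h2, sum_toward]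
  have hterm : ∀ i ∈ Finset.range n, ((if i + 1 = 0 then x
        else some Msg.finish).elim 0 cost) ≤ hi := by
    intro i _
    rw [if_neg (Nat.succ_ne_zero _)]
    exact hc.finish
  have := Finset.sum_le_sum hterm
  rw [Finset.sum_const, Finset.card_range, nsmul_eq_mul] at this
  simp only [Option.elim_none]
  linarith

/-- Phase 2 computes the estimate `2 ^ (⌊log p⌋ + 1)` of `p`. -/
theorem phase_two (hc : CostBounds inp cost lo hi) {L : Fin n} {E : ℕ} {s : Fin n → AgentState m}
    (hrun : (syncBalance n m).run inp E = ⟨s, toward L none, fun _ => none⟩)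
    (hs : ∀ a, (s a).mode = .estimate E 0 ∧ (s a).label = dist L a ∧ (s a).spoken = 0 ∧
        (s a).assigned = ∅ ∧ (s a).mine = ∅) :
    ∃ (S : ℕ) (s' : Fin n → AgentState m), S = E + (Nat.log 2 (maxWeight inp) + 2) * n + 1 ∧
      (syncBalance n m).run inp S = ⟨s', toward L none, fun _ => none⟩ ∧
      (∀ a, (s' a).mode = .step1 S 0 ∧ (s' a).label = dist L a ∧
        (s' a).pUB = 2 ^ (Nat.log 2 (maxWeight inp) + 1) ∧ (s' a).assigned = ∅ ∧
        (s' a).mine = ∅) ∧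
      (syncBalance n m).totalCost inp cost S ≤
        (syncBalance n m).totalCost inp cost E + hi * n * n + hi * n := by
  have h0 : spokenBefore inp 0 = 0 := by simp [spokenBefore]
  have key : ∀ r ≤ Nat.log 2 (maxWeight inp) + 1, ∃ s' x',
      EstimateStage inp L r (E + r * n) s' x' ∧
      (syncBalance n m).totalCost inp cost (E + r * n) ≤
        (syncBalance n m).totalCost inp cost E + hi * n * spokenBefore inp r := by
    intro r
    induction r with
    | zero =>
      refine fun _ => ⟨s, none, ⟨by simpa using hrun, fun a => by simpa using (hs a).1,
        fun a => (hs a).2.1, fun a => (hs a).2.2.2.1, fun a => (hs a).2.2.2.2, ?_⟩, ?_⟩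
      · rw [(hs L).2.2.1, h0]; rfl
      · rw [h0]; simp
    | succ r ih =>
      intro hr
      obtain ⟨s', x', h1, h2⟩ := ih (by omega)
      obtain ⟨s'', x'', h3, h4⟩ := h1.succ hc (by omega)
      have e : E + (r + 1) * n = E + r * n + n := by ring
      rw [e]
      exact ⟨s'', x'', h3, by linarith⟩
  obtain ⟨s', x', h1, h2⟩ := key _ le_rfl
  obtain ⟨s'', h3, h4, h5⟩ := h1.finish hc rfl
  have e : E + (Nat.log 2 (maxWeight inp) + 1) * n + n + 1 =
      E + (Nat.log 2 (maxWeight inp) + 2) * n + 1 := by ring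
  rw [e] at h3 h4 h5
  refine ⟨_, s'', rfl, h3, h4, h5.trans ?_⟩
  have : (spokenBefore inp (Nat.log 2 (maxWeight inp) + 1) : ℝ) ≤ n := by
    exact_mod_cast spokenBefore_le _
  have := mul_le_mul_of_nonneg_left this (mul_nonneg hc.hi_nonneg (Nat.cast_nonneg n))
  linarith

end Estimate

/-! ### Quotas, and the combinatorics of assigning colors. -/

section Assignment

variable {n m : ℕ}

theorem sum_range_ite_lt (n g : ℕ) : ∑ i ∈ Finset.range n, (if i < g then 0 else 1) = n - g := by
  induction n with
  | zero => simp
  | succ n ih =>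
    rw [Finset.sum_range_succ, ih]
    split_ifs <;> omega

/-- With `g = (m / n + 1) * n - m` small quotas the sum is `n * (m / n) + (n - g)`, and `g` is
chosen to make this `m`. -/
theorem sum_quota (hn : 0 < n) : ∑ i ∈ Finset.range n, quota n m i = m := by
  have h : ∀ i, quota n m i = m / n + if i < (m / n + 1) * n - m then 0 else 1 := by
    intro i
    unfold quota
    split_ifs <;> rfl
  simp only [h, Finset.sum_add_distrib, sum_range_ite_lt, Finset.sum_const, Finset.card_range,
    smul_eq_mul]
  have h1 := Nat.div_add_mod m n
  have h2 := Nat.mod_lt m hn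
  have h3 : (m / n + 1) * n = n * (m / n) + n := by ring
  omega

theorem div_le_quota (i : ℕ) : m / n ≤ quota n m i := by
  unfold quota
  split_ifs <;> omega

/-- If `n` divides `m`, all labels are below the threshold and the larger quota does not occur. -/
theorem quota_le_ceilDiv (hn : 0 < n) {i : ℕ} (hi : i < n) : quota n m i ≤ m ⌈/⌉ n := by
  rw [Nat.ceilDiv_eq_add_pred_div]
  have h1 := Nat.div_add_mod m n
  have h2 := Nat.mod_lt m hn
  have h3 : (m / n + 1) * n = n * (m / n) + n := by ring
  unfold quota
  rw [Nat.le_div_iff_mul_le hn]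
  have h4 : m / n * n = n * (m / n) := by ring
  split_ifs with h
  · rw [h4]; omega
  · rw [h3] at h ⊢; omega

/-- The intervals of the stages of Phase 3 cover all numbers. -/
theorem exists_inInterval {e : ℕ} (he : 0 < e) (w : ℕ) : ∃ r ≤ e, InInterval (2 ^ e) r w := by
  obtain ⟨e, rfl⟩ : ∃ e', e = e' + 1 := ⟨e - 1, by omega⟩
  have hlog : Nat.log 2 (2 ^ (e + 1)) = e + 1 := Nat.log_pow (by norm_num) _
  have hhalf : 2 ^ (e + 1) / 2 = 2 ^ e := by rw [pow_succ]; omega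
  rcases Nat.eq_zero_or_pos w with rfl | hw
  · exact ⟨e + 1, le_rfl, by simp [InInterval, hlog]⟩
  · rcases le_or_gt (2 ^ e) w with h | h
    · exact ⟨0, by omega, by simp [InInterval, hhalf, h]⟩
    · have hl : Nat.log 2 w < e := Nat.log_lt_of_lt_pow hw.ne' h
      -- With `p' = 2 ^ (e + 1)` this stage has the interval `[2 ^ l, 2 ^ (l + 1))`, where `l =
      -- Nat.log 2 w`.
      refine ⟨e - Nat.log 2 w, by omega, ?_⟩
      rw [InInterval, if_neg (by omega), if_pos (by omega),
        Nat.pow_div (by omega) (by norm_num), Nat.pow_div (by omega) (by norm_num),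
        (by omega : e + 1 - (e - Nat.log 2 w + 1) = Nat.log 2 w),
        (by omega : e + 1 - (e - Nat.log 2 w) = Nat.log 2 w + 1)]
      exact ⟨Nat.pow_log_le_self 2 hw.ne', Nat.lt_pow_succ_log_self (by norm_num) w⟩

/-- The colors in `A` are distributed among the agents within their quotas, `mine a` being the share
of `a`, and a color that is not yet assigned and whose weight for `a` belongs to one of the stages
before `r` could not be taken by `a` because the quota of `a` is filled. -/
structure PartialAssignment (inp : Fin n → Input m) (L : Fin n) (P r : ℕ) (A : Finset (Fin m))
    (mine : Fin n → Finset (Fin m)) : Prop where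
  disjoint : ∀ a b, a ≠ b → Disjoint (mine a) (mine b)
  mem_iff : ∀ j, j ∈ A ↔ ∃ a, j ∈ mine a
  card_le : ∀ a, (mine a).card ≤ quota n m (dist L a)
  filled : ∀ j ∉ A, ∀ a, ∀ r' < r, InInterval P r' ((inp a).weight j) →
    quota n m (dist L a) ≤ (mine a).card

variable {inp : Fin n → Input m} {L : Fin n} {P r : ℕ} {A : Finset (Fin m)}
  {mine : Fin n → Finset (Fin m)}

theorem PartialAssignment.empty : PartialAssignment inp L P 0 ∅ fun _ => ∅ :=
  ⟨fun _ _ _ => Finset.disjoint_empty_left _, fun _ => by simp, fun _ => by simp,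
    fun _ _ _ _ h => absurd h (Nat.not_lt_zero _)⟩

theorem PartialAssignment.sum_card (h : PartialAssignment inp L P r A mine) :
    ∑ a, (mine a).card = A.card := by
  rw [← Finset.card_biUnion fun a _ b _ hab => h.disjoint a b hab]
  congr 1
  ext j
  simp [h.mem_iff]

/-- For every agent, the weight of a left-over color lies in the interval of some completed stage,
so by `filled` every quota is exhausted. Then `m` colors are assigned, a contradiction. -/
theorem PartialAssignment.eq_univ {e : ℕ} (he : 0 < e)
    (h : PartialAssignment inp L (2 ^ e) (e + 1) A mine) : A = Finset.univ := by
  by_contra hA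
  obtain ⟨j, hj⟩ : ∃ j, j ∉ A := by
    by_contra! hall
    exact hA (Finset.eq_univ_of_forall hall)
  have hlt : A.card < m := by
    simpa using Finset.card_lt_univ_of_notMem hj
  have : m ≤ A.card := by
    rw [← h.sum_card]
    refine (sum_quota L.pos).ge.trans ?_
    rw [← sum_dist L]
    refine Finset.sum_le_sum fun a _ => ?_
    obtain ⟨r', hr', hw⟩ := exists_inInterval he ((inp a).weight j)
    exact h.filled j hj a r' (by omega) hw
  omega

/-- Shares and quotas have the same sum `m`, and no share exceeds its quota. -/
theorem PartialAssignment.card_eq (h : PartialAssignment inp L P r Finset.univ mine) (a : Fin n) :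
    (mine a).card = quota n m (dist L a) := by
  have hsum : ∑ a, (mine a).card = ∑ a, quota n m (dist L a) := by
    rw [h.sum_card, sum_dist L, sum_quota L.pos]
    simp
  exact (Finset.sum_eq_sum_iff_of_le fun a _ => h.card_le a).1 hsum a (Finset.mem_univ a)

theorem PartialAssignment.exists_balancedColoring
    (h : PartialAssignment inp L P r Finset.univ mine) :
    ∃ π : Fin m → Fin n, IsBalancedColoring π ∧ ∀ a j, j ∈ mine a ↔ π j = a := by
  have hex : ∀ j, ∃ a, j ∈ mine a := fun j => (h.mem_iff j).1 (Finset.mem_univ j)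
  choose π hπ using hex
  have hiff : ∀ a j, j ∈ mine a ↔ π j = a := by
    intro a j
    constructor
    · intro hj
      by_contra hne
      exact Finset.disjoint_left.1 (h.disjoint _ _ hne) (hπ j) hj
    · rintro rfl
      exact hπ j
  refine ⟨π, fun a => ?_, hiff⟩
  have : (Finset.univ.filter fun j => π j = a) = mine a := by
    ext j
    simp [hiff]
  rw [this, h.card_eq]
  exact ⟨div_le_quota _, quota_le_ceilDiv L.pos (dist_lt L a)⟩

/-- The state `s` at the beginning of a stage of Phase 3: the colors in `A` are assigned. -/
structure StageVars (L : Fin n) (P : ℕ) (A : Finset (Fin m)) (s : Fin n → AgentState m) : Prop where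
  label : ∀ a, (s a).label = dist L a
  pUB : ∀ a, (s a).pUB = P
  assigned : ∀ a, (s a).assigned = A

variable {s : Fin n → AgentState m}

theorem mem_assignable_iff (hs : StageVars L P A s) {a : Fin n} {j : Fin m} :
    j ∈ assignable n (inp a) (s a) r ↔ (s a).mine.card < quota n m (dist L a) ∧ j ∉ A ∧
      InInterval P r ((inp a).weight j) := by
  unfold assignable
  rw [hs.label, hs.pUB, hs.assigned]
  split_ifs with h <;> simp [h]

theorem PartialAssignment.succ_of_assignable_eq_empty (hs : StageVars L P A s)
    (h : PartialAssignment inp L P r A fun a => (s a).mine)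
    (hempty : ∀ a, assignable n (inp a) (s a) r = ∅) :
    PartialAssignment inp L P (r + 1) A fun a => (s a).mine := by
  refine ⟨h.disjoint, h.mem_iff, h.card_le, fun j hj a r' hr' hw => ?_⟩
  rcases Nat.lt_succ_iff_lt_or_eq.1 hr' with hlt | rfl
  · exact h.filled j hj a r' hlt hw
  · by_contra hlt
    have := (mem_assignable_iff (inp := inp) hs).2 ⟨not_le.1 hlt, hj, hw⟩
    rw [hempty] at this
    exact absurd this (Finset.notMem_empty j)

/-- The colors that agent `a` assigns to itself when the list `l` arrives. -/
def newColors (inp : Fin n → Input m) (s : Fin n → AgentState m) (r : ℕ) (a : Fin n)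
    (l : Finset (Fin m)) : Finset (Fin m) :=
  (inp a).choose (assignable n (inp a) (s a) r \ l) (quota n m (s a).label - (s a).mine.card)

/-- The list of colors that arrives at the agent with label `i` in Step 2. -/
def colorList (inp : Fin n → Input m) (L : Fin n) (s : Fin n → AgentState m) (r : ℕ) :
    ℕ → Finset (Fin m)
  | 0 => ∅
  | i + 1 => colorList inp L s r i ∪ newColors inp s r (next^[i] L) (colorList inp L s r i)

/-- The colors that agent `a` assigns to itself in stage `r`. -/
def share (inp : Fin n → Input m) (L : Fin n) (s : Fin n → AgentState m) (r : ℕ) (a : Fin n) :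
    Finset (Fin m) :=
  newColors inp s r a (colorList inp L s r (dist L a))

theorem colorList_dist_succ (a : Fin n) : colorList inp L s r (dist L a + 1) =
    colorList inp L s r (dist L a) ∪ share inp L s r a := by
  rw [colorList, iterate_next_dist, share]

theorem colorList_mono {i j : ℕ} (hij : i ≤ j) :
    colorList inp L s r i ⊆ colorList inp L s r j := by
  induction j, hij using Nat.le_induction with
  | base => exact Finset.Subset.refl _
  | succ j _ ih => exact ih.trans Finset.subset_union_left

theorem mem_colorList {i : ℕ} (hi : i ≤ n) (j : Fin m) :
    j ∈ colorList inp L s r i ↔ ∃ a, dist L a < i ∧ j ∈ share inp L s r a := by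
  induction i with
  | zero => simp [colorList]
  | succ i ih =>
    have hd := dist_iterate_next L (i := i) (by omega)
    have := colorList_dist_succ (inp := inp) (s := s) (r := r) (L := L) (next^[i] L)
    rw [hd] at this
    rw [this, Finset.mem_union, ih (by omega)]
    constructor
    · rintro (⟨a, ha, hj⟩ | hj)
      · exact ⟨a, by omega, hj⟩
      · exact ⟨_, by omega, hj⟩
    · rintro ⟨a, ha, hj⟩
      rcases Nat.lt_succ_iff_lt_or_eq.1 ha with hlt | heq
      · exact Or.inl ⟨a, hlt, hj⟩
      · rw [dist_eq_iff L a (by omega)] at heq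
        exact Or.inr (heq ▸ hj)

theorem share_subset_colorList (a : Fin n) : share inp L s r a ⊆ colorList inp L s r n :=
  fun j hj => (mem_colorList le_rfl j).2 ⟨a, dist_lt L a, hj⟩

theorem share_subset (hsel : ∀ a, SelectsMax (inp a).choose) (a : Fin n) :
    share inp L s r a ⊆ assignable n (inp a) (s a) r \ colorList inp L s r (dist L a) :=
  (hsel a _ _).1

theorem card_share (hsel : ∀ a, SelectsMax (inp a).choose) (hs : StageVars L P A s) (a : Fin n) :
    (share inp L s r a).card = min (quota n m (dist L a) - (s a).mine.card)
      (assignable n (inp a) (s a) r \ colorList inp L s r (dist L a)).card := by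
  rw [share, newColors, (hsel a _ _).2, hs.label]

/-- Of two agents, the one served later finds the share of the other on its list and avoids it. -/
theorem share_disjoint (hsel : ∀ a, SelectsMax (inp a).choose) {a b : Fin n} (hab : a ≠ b) :
    Disjoint (share inp L s r a) (share inp L s r b) := by
  wlog hlt : dist L a < dist L b generalizing a b
  · refine (this hab.symm ?_).symm
    have : dist L a ≠ dist L b := fun h => hab (dist_injective L h)
    omega
  refine Finset.disjoint_left.2 fun j ha hb => ?_
  have := (Finset.mem_sdiff.1 (share_subset hsel b hb)).2
  exact this ((mem_colorList (dist_lt L b).le j).2 ⟨a, hlt, ha⟩)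

theorem notMem_of_mem_share (hsel : ∀ a, SelectsMax (inp a).choose) (hs : StageVars L P A s)
    {a : Fin n} {j : Fin m} (hj : j ∈ share inp L s r a) : j ∉ A :=
  ((mem_assignable_iff hs).1 (Finset.mem_sdiff.1 (share_subset hsel a hj)).1).2.1

/-- The point is `filled` for the stage `r` itself. An agent with room left after it was not limited
by its quota, so by maximality of the selection it took everything assignable that was not yet on
the list; hence each color it could have taken is on the final list. -/
theorem PartialAssignment.succ (hsel : ∀ a, SelectsMax (inp a).choose) (hs : StageVars L P A s)
    (h : PartialAssignment inp L P r A fun a => (s a).mine) :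
    PartialAssignment inp L P (r + 1) (A ∪ colorList inp L s r n)
      fun a => (s a).mine ∪ share inp L s r a := by
  have hdisj : ∀ a b, Disjoint (s a).mine (share inp L s r b) := fun a b =>
    Finset.disjoint_left.2 fun j h1 h2 =>
      notMem_of_mem_share hsel hs h2 ((h.mem_iff j).2 ⟨a, h1⟩)
  have hcard : ∀ a, ((s a).mine ∪ share inp L s r a).card =
      (s a).mine.card + min (quota n m (dist L a) - (s a).mine.card)
        (assignable n (inp a) (s a) r \ colorList inp L s r (dist L a)).card := fun a => by
    rw [Finset.card_union_of_disjoint (hdisj a a), card_share hsel hs]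
  refine ⟨fun a b hab => ?_, fun j => ?_, fun a => ?_, fun j hj a r' hr' hw => ?_⟩
  · rw [Finset.disjoint_union_left, Finset.disjoint_union_right, Finset.disjoint_union_right]
    exact ⟨⟨h.disjoint a b hab, hdisj a b⟩, (hdisj b a).symm, share_disjoint hsel hab⟩
  · rw [Finset.mem_union, h.mem_iff, mem_colorList le_rfl]
    simp only [Finset.mem_union, dist_lt, true_and, exists_or]
  · have := h.card_le a
    rw [hcard]
    omega
  · rw [Finset.mem_union, not_or] at hj
    rcases Nat.lt_succ_iff_lt_or_eq.1 hr' with hlt | rfl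
    · exact (h.filled j hj.1 a r' hlt hw).trans (Finset.card_le_card Finset.subset_union_left)
    · by_contra hlt
      rw [not_le] at hlt
      have hm : (s a).mine.card < quota n m (dist L a) :=
        (Finset.card_le_card Finset.subset_union_left).trans_lt hlt
      have hj1 : j ∈ assignable n (inp a) (s a) r' \ colorList inp L s r' (dist L a) :=
        Finset.mem_sdiff.2 ⟨(mem_assignable_iff hs).2 ⟨hm, hj.1, hw⟩,
          fun h => hj.2 (colorList_mono (dist_lt L a).le h)⟩
      rw [hcard] at hlt
      have heq : share inp L s r' a =
          assignable n (inp a) (s a) r' \ colorList inp L s r' (dist L a) := by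
        refine Finset.eq_of_subset_of_card_le (share_subset hsel a) ?_
        rw [card_share hsel hs]
        omega
      rw [← heq] at hj1
      exact hj.2 (share_subset_colorList a hj1)

theorem card_union_colorList (hsel : ∀ a, SelectsMax (inp a).choose) (hs : StageVars L P A s) :
    (A ∪ colorList inp L s r n).card = A.card + (colorList inp L s r n).card := by
  refine Finset.card_union_of_disjoint (Finset.disjoint_right.2 fun j hj => ?_)
  obtain ⟨a, -, ha⟩ := (mem_colorList le_rfl j).1 hj
  exact notMem_of_mem_share hsel hs ha

/-- An assignable color of `a` is either on the list already or leaves `a` something to take. So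
Step 2 does send a list, and its overhead can be charged to at least one new color. -/
theorem colorList_nonempty (hsel : ∀ a, SelectsMax (inp a).choose) (hs : StageVars L P A s)
    {a : Fin n} (ha : assignable n (inp a) (s a) r ≠ ∅) : (colorList inp L s r n).Nonempty := by
  obtain ⟨j, hj⟩ := Finset.nonempty_iff_ne_empty.2 ha
  by_cases hl : j ∈ colorList inp L s r (dist L a)
  · exact ⟨j, colorList_mono (dist_lt L a).le hl⟩
  · have hq := ((mem_assignable_iff (inp := inp) hs).1 hj).1
    have hpos := Finset.card_pos.2 ⟨j, Finset.mem_sdiff.2 ⟨hj, hl⟩⟩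
    have : 0 < (share inp L s r a).card := by
      rw [card_share hsel hs]
      omega
    obtain ⟨i, hi⟩ := Finset.card_pos.1 this
    exact ⟨i, share_subset_colorList a hi⟩

end Assignment

/-! ### Phase 3: silent stages, and Step 1 of productive ones. -/

section Stage

variable {n m : ℕ} {inp : Fin n → Input m} {cost : Msg m → ℝ} {lo hi : ℝ}
  {L : Fin n} {P r S : ℕ} {A : Finset (Fin m)} {s : Fin n → AgentState m} {x : Option (Msg m)}

/-- The configuration at the beginning of stage `r` of Phase 3, in round `S`. -/
structure AssignStage (inp : Fin n → Input m) (L : Fin n) (P r S : ℕ) (A : Finset (Fin m))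
    (s : Fin n → AgentState m) (x : Option (Msg m)) : Prop extends StageVars L P A s where
  run : (syncBalance n m).run inp S = ⟨s, toward L x, fun _ => none⟩
  -- The list of the previous stage may still be arriving at `L`. It is harmless because only labels
  -- matter in Step 1.
  no_speaker : ∀ k, x ≠ some (.speaker k)
  mode : ∀ a, (s a).mode = .step1 S r
  partial_assignment : PartialAssignment inp L P r A fun a => (s a).mine

/-- The mode in which an agent leaves stage `r` of Phase 3, if the next stage begins in round `S`
and the colors in `A` are now assigned. -/
def modeAfter (P r S : ℕ) (A : Finset (Fin m)) : Mode :=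
  if A = Finset.univ then .halted else
    if r + 1 ≤ Nat.log 2 P then .step1 S (r + 1) else .halted

/-- The configuration at the end of stage `r` of Phase 3, in round `S`. -/
structure StageEnd (inp : Fin n → Input m) (L : Fin n) (P r S : ℕ) (A : Finset (Fin m))
    (s : Fin n → AgentState m) (x : Option (Msg m)) : Prop extends StageVars L P A s where
  run : (syncBalance n m).run inp S = ⟨s, toward L x, fun _ => none⟩
  no_speaker : ∀ k, x ≠ some (.speaker k)
  mode : ∀ a, (s a).mode = modeAfter P r S A
  partial_assignment : PartialAssignment inp L P (r + 1) A fun a => (s a).mine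

theorem step1Act_idle {i : Input m} {t S r : ℕ} {s : AgentState m} {x : Option (Msg m)}
    (h1 : t ≠ S + s.label) (h2 : t ≠ S + s.label + n) :
    step1Act n i t s S r x = (s, none, none) := by
  simp only [step1Act, if_neg h1, if_neg h2]

theorem step1Act_silent {i : Input m} {S r d : ℕ} {s : AgentState m} {x : Option (Msg m)}
    (hd : s.label = d) (hx : ∀ k, x ≠ some (.speaker k)) (h : assignable n i s r = ∅) :
    step1Act n i (S + d) s S r x = (s, none, none) := by
  subst hd
  simp only [step1Act, if_true, h, ne_eq, not_true_eq_false, if_false]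

theorem step1Act_speak {i : Input m} {S r d : ℕ} {s : AgentState m} {x : Option (Msg m)}
    (hd : s.label = d) (hx : ∀ k, x ≠ some (.speaker k)) (h : assignable n i s r ≠ ∅) :
    step1Act n i (S + d) s S r x =
      ({ s with mode := .step2 (S + d + (n - 1)) r }, some (.speaker d), none) := by
  subst hd
  simp only [step1Act, if_true, if_pos h]

theorem step1Act_forward {i : Input m} {S r k d : ℕ} {s : AgentState m} (hd : s.label = d) :
    step1Act n i (S + d) s S r (some (.speaker k)) =
      ({ s with mode := .step2 (S + d + (n + k - d - 1)) r }, some (.speaker k), none) := by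
  subst hd
  simp only [step1Act, if_true]

theorem step1Act_late_forward {i : Input m} {S r k d : ℕ} {s : AgentState m} (hd : s.label = d)
    (hn : 0 < n) (hk : k - d - 1 ≠ 0) :
    step1Act n i (S + d + n) s S r (some (.speaker k)) =
      ({ s with mode := .step2 (S + d + n + (k - d - 1)) r }, some (.speaker k), none) := by
  subst hd
  simp only [step1Act, if_true]
  rw [if_neg (by omega), if_neg hk]

theorem step1Act_last {i : Input m} {S r k d : ℕ} {s : AgentState m} (hd : s.label = d)
    (hn : 0 < n) (hk : k - d - 1 = 0) :
    step1Act n i (S + d + n) s S r (some (.speaker k)) =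
      step2Act n i (S + d + n) { s with mode := .step2 (S + d + n) r } (S + d + n) r none := by
  subst hd
  simp only [step1Act, if_true]
  rw [if_neg (by omega), if_pos hk]

theorem step1Act_next {i : Input m} {S r d : ℕ} {s : AgentState m} (hd : s.label = d)
    (hn : 0 < n) :
    step1Act n i (S + d + n) s S r none =
      ({ s with mode := nextStage s (S + d + n + (n - d)) r }, none, none) := by
  subst hd
  simp only [step1Act, if_true]
  rw [if_neg (by omega)]

theorem step2Act_idle {i : Input m} {t S r : ℕ} {s : AgentState m} {x : Option (Msg m)}
    (hx : ∀ l, x ≠ some (.colors l)) (h : t ≠ S + s.label) :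
    step2Act n i t s S r x = (s, none, none) := by
  simp only [step2Act, if_neg h]
  split_ifs <;> rfl

/-- Halted agents and agents that wait for the next stage alike ignore whatever arrives. -/
theorem act_modeAfter {i : Input m} {t : ℕ} {s : AgentState m} {y : Option (Msg m)}
    (h : s.mode = modeAfter P r S A) (ht : t < S + s.label) :
    (syncBalance n m).act i t s x y = (s, none, none) := by
  unfold modeAfter at h
  split_ifs at h
  · exact act_halted h
  · rw [act_step1 h, step1Act_wait ht]
  · exact act_halted h

/-- A stage in which no agent can assign itself a color. -/
theorem AssignStage.silent (h : AssignStage inp L P r S A s x) (hA : A ≠ Finset.univ)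
    (hempty : ∀ a, assignable n (inp a) (s a) r = ∅) :
    ∃ s', StageEnd inp L P r (S + 2 * n) A s' none ∧
      (syncBalance n m).totalCost inp cost (S + 2 * n) = (syncBalance n m).totalCost inp cost S := by
  have hn := L.pos
  obtain ⟨h1, h2⟩ := full_sweep inp cost L S s s
    (fun i => if i = 0 then x else none)
    (fun a t _ ht => by
      rw [act_step1 (h.mode a), step1Act_wait (by rw [h.label]; exact ht)])
    (fun a => by
      rw [act_step1 (h.mode a), step1Act_silent (h.label a) ?_ (hempty a),
        if_neg (Nat.succ_ne_zero _)]
      intro k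
      split_ifs
      · exact h.no_speaker k
      · simp)
    (fun a t h1 h2 => by
      rw [act_step1 (h.mode a), step1Act_idle] <;> rw [h.label] <;> omega)
    (by simpa using h.run)
  simp only [if_neg hn.ne'] at h1
  obtain ⟨h3, h4⟩ := full_sweep inp cost L (S + n) s
    (fun a => { s a with mode := modeAfter P r (S + 2 * n) A })
    (fun _ => none)
    (fun a t h1 h2 => by
      have := dist_lt L a
      rw [act_step1 (h.mode a), step1Act_idle] <;> rw [h.label] <;> omega)
    (fun a => by
      have := dist_lt L a
      -- In a silent stage agents do not test whether all colors are assigned; by `hA` the test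
      -- would fail anyway.
      have e : nextStage (s a) (S + 2 * n) r = modeAfter P r (S + 2 * n) A := by
        simp only [nextStage, modeAfter, h.pUB, if_neg hA]
      rw [act_step1 (h.mode a), (by omega : S + n + dist L a = S + dist L a + n),
        step1Act_next (h.label a) hn,
        (by omega : S + dist L a + n + (n - dist L a) = S + 2 * n), e])
    (fun a t h1 h2 => by
      rw [act_modeAfter rfl]
      simp only
      omega)
    h1
  have e : S + n + n = S + 2 * n := by ring
  rw [e] at h3 h4
  refine ⟨fun a => { s a with mode := modeAfter P r (S + 2 * n) A },
    ⟨⟨h.label, h.pUB, h.assigned⟩, h3, by simp, fun a => rfl,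
    PartialAssignment.succ_of_assignable_eq_empty (s := s) h.toStageVars
      h.partial_assignment hempty⟩, ?_⟩
  rw [h4, h2]
  simp

/-- Step 1 of a stage in which `K` is the first agent that can assign itself a color, up to the
beginning of Step 2. -/
theorem AssignStage.speaker_wave (hn : 2 ≤ n) (hc : CostBounds inp cost lo hi)
    (h : AssignStage inp L P r S A s x) {K : Fin n}
    (hK : assignable n (inp K) (s K) r ≠ ∅)
    (hmin : ∀ a, dist L a < dist L K → assignable n (inp a) (s a) r = ∅) :
    (syncBalance n m).run inp (S + n + dist L K - 1) =
      ⟨fun a => if a = prev K then s a else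
          { s a with mode := .step2 (S + n + dist L K - 1) r },
        toward (prev K) (some (.speaker (dist L K))), fun _ => none⟩ ∧
    (syncBalance n m).totalCost inp cost S ≤
      (syncBalance n m).totalCost inp cost (S + n + dist L K - 1) ∧
    (syncBalance n m).totalCost inp cost (S + n + dist L K - 1) ≤
      (syncBalance n m).totalCost inp cost S + 2 * n * hi := by
  have hkn := dist_lt L K
  have hprevK : prev K = next^[(dist L K + n - 1) % n] L := by
    apply Fin.ext
    have h1 := val_iterate_next L (dist L K)
    rw [iterate_next_dist] at h1
    rw [val_iterate_next, Nat.add_mod_mod]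
    simp only [prev]
    rw [h1, Nat.add_sub_assoc (by omega), Nat.mod_add_mod]
    congr 1
    omega
  generalize hk : dist L K = k at *
  -- The states after the first lap: agents before `K` have heard nothing, the others know the label
  -- `k`.
  set st₁ : Fin n → AgentState m := fun a => if dist L a < k then s a else
    { s a with mode := .step2 (S + n + k - 1) r } with hst₁
  have hlabel : ∀ a, (st₁ a).label = dist L a := fun a => by
    simp only [hst₁]
    split_ifs <;> exact h.label a
  have hcsp : 0 ≤ cost (.speaker k) ∧ cost (.speaker k) ≤ hi :=
    ⟨hc.nonneg _, hc.speaker k (by omega)⟩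
  -- The length is left open: for `k = 0`, Step 2 begins in round `S + n - 1`, just when agent `n -
  -- 1` has its first turn, and the wave must be cut off before.
  have waveA := fun j₁ (hj : j₁ ≤ n) (hj0 : k = 0 → j₁ < n) => sweep inp cost L S 0 j₁
    (Nat.zero_le _) hj s st₁
    (fun i => if i = 0 then x else if i ≤ k then none else some (.speaker k))
    (fun a t _ ht _ => by
      rw [act_step1 (h.mode a), step1Act_wait (by rw [h.label]; exact ht)])
    (fun a _ _ => by
      have hd := dist_lt L a
      rw [act_step1 (h.mode a), if_neg (Nat.succ_ne_zero _)]
      have hin : dist L a ≤ k → ∀ k', (if dist L a = 0 then x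
          else if dist L a ≤ k then none else some (.speaker k)) ≠ some (.speaker k') := by
        intro hle k'
        rw [if_pos hle]
        split_ifs
        · exact h.no_speaker k'
        · simp
      rcases lt_trichotomy (dist L a) k with hlt | heq | hgt
      · have := step1Act_silent (n := n) (S := S) (h.label a) (hin hlt.le) (hmin a hlt)
        rw [this, if_pos (by omega)]
        simp only [hst₁, if_pos hlt]
      · have haK : a = K := dist_injective L (heq.trans hk.symm)
        have := step1Act_speak (n := n) (S := S) (h.label a) (hin heq.le)
          (by rw [haK]; exact hK : assignable n (inp a) (s a) r ≠ ∅)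
        rw [this, if_neg (by omega)]
        simp only [hst₁, if_neg (by omega : ¬ dist L a < k)]
        rw [(by omega : S + dist L a + (n - 1) = S + n + k - 1), heq]
      · have := step1Act_forward (n := n) (S := S) (i := inp a) (k := k) (r := r) (h.label a)
        rw [if_neg (by omega), if_neg (by omega), if_neg (by omega), this]
        simp only [hst₁, if_neg (by omega : ¬ dist L a < k)]
        rw [(by omega : S + dist L a + (n + k - dist L a - 1) = S + n + k - 1)])
    (fun a t _ h2 h3 => by
      by_cases hlt : dist L a < k
      · have e : st₁ a = s a := by simp only [hst₁, if_pos hlt]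
        rw [e, act_step1 (h.mode a), step1Act_idle] <;> rw [h.label] <;> omega
      · have e : (st₁ a).mode = .step2 (S + n + k - 1) r := by simp only [hst₁, if_neg hlt]
        rw [act_step2 e, step2Act_wait]
        rw [hlabel]
        rcases Nat.eq_zero_or_pos k with h0 | h0
        · have := hj0 h0
          omega
        · omega)
    (by rw [front_zero]; exact h.run)
  have hsumA : ∀ j₁ ≤ n,
      0 ≤ ∑ i ∈ Finset.Ico 0 j₁, ((if i + 1 = 0 then x else if i + 1 ≤ k then none
        else some (Msg.speaker k)).elim 0 cost) ∧
      ∑ i ∈ Finset.Ico 0 j₁, ((if i + 1 = 0 then x else if i + 1 ≤ k then none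
        else some (Msg.speaker k)).elim 0 cost) ≤ n * hi := by
    intro j₁ hj
    have hterm : ∀ i, 0 ≤ ((if i + 1 = 0 then x else if i + 1 ≤ k then none
      else some (Msg.speaker k)).elim 0 cost) ∧ ((if i + 1 = 0 then x else if i + 1 ≤ k then none
      else some (Msg.speaker k)).elim 0 cost) ≤ hi := by
      intro i
      rw [if_neg (Nat.succ_ne_zero _)]
      split_ifs
      · exact ⟨le_rfl, hc.hi_nonneg⟩
      · exact hcsp
    refine ⟨Finset.sum_nonneg fun i _ => (hterm i).1, ?_⟩
    refine (Finset.sum_le_sum fun i _ => (hterm i).2).trans ?_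
    rw [Finset.sum_const, Nat.card_Ico, nsmul_eq_mul]
    exact mul_le_mul_of_nonneg_right (by exact_mod_cast (by omega)) hc.hi_nonneg
  have hnhi : 0 ≤ n * hi := mul_nonneg (Nat.cast_nonneg _) hc.hi_nonneg
  rcases Nat.eq_zero_or_pos k with h0 | h0
  · obtain ⟨h1, h2⟩ := waveA (n - 1) (by omega) (by omega)
    obtain ⟨h3, h4⟩ := hsumA (n - 1) (by omega)
    have e : S + n + k - 1 = S + (n - 1) := by omega
    have e' : (k + n - 1) % n = n - 1 := by
      rw [h0, Nat.zero_add, Nat.mod_eq_of_lt (by omega)]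
    rw [e'] at hprevK
    rw [e, h1, h2, hprevK, if_neg (by omega), if_neg (by omega)]
    refine ⟨?_, by simp only [Nat.add_zero]; linarith, by simp only [Nat.add_zero]; linarith⟩
    congr 1
    funext a
    have hiff := dist_eq_iff L a (i := n - 1) (by omega)
    have hd := dist_lt L a
    simp only [← hiff, front, hst₁, e]
    split_ifs <;> first | rfl | omega
  · obtain ⟨h1, h2⟩ := waveA n le_rfl (by omega)
    obtain ⟨h3, h4⟩ := hsumA n le_rfl
    rw [if_neg (by omega), if_neg (by omega), front_card, iterate_next_card] at h1
    -- In the second lap the label reaches the agents before `K`. It is stopped short of the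
    -- predecessor of `K`, whose turn is the first round of Step 2.
    obtain ⟨h5, h6⟩ := sweep inp cost L (S + n) 0 (k - 1) (Nat.zero_le _) (by omega) st₁
      (fun a => { s a with mode := .step2 (S + n + k - 1) r })
      (fun _ => some (.speaker k))
      (fun a t h1 h2 h3 => by
        have hd := dist_lt L a
        by_cases hlt : dist L a < k
        · have e : st₁ a = s a := by simp only [hst₁, if_pos hlt]
          rw [e, act_step1 (h.mode a), step1Act_idle] <;> rw [h.label] <;> omega
        · have e : (st₁ a).mode = .step2 (S + n + k - 1) r := by simp only [hst₁, if_neg hlt]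
          rw [act_step2 e, step2Act_wait]
          rw [hlabel]
          omega)
      (fun a _ h2 => by
        have e : st₁ a = s a := by
          simp only [hst₁]
          rw [if_pos (by omega)]
        have := step1Act_late_forward (n := n) (S := S) (i := inp a) (k := k) (r := r)
          (h.label a) (by omega) (by omega)
        rw [e, act_step1 (h.mode a), (by omega : S + n + dist L a = S + dist L a + n), this,
          (by omega : S + dist L a + n + (k - dist L a - 1) = S + n + k - 1)])
      (fun a t h1 h2 h3 => by
        rw [act_step2 rfl, step2Act_wait]
        simp only
        omega)
      (by rw [front_zero]; exact h1)
    have e : S + n + k - 1 = S + n + (k - 1) := by omega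
    have e' : (k + n - 1) % n = k - 1 := by
      rw [(by omega : k + n - 1 = k - 1 + n), Nat.add_mod_right, Nat.mod_eq_of_lt (by omega)]
    rw [e'] at hprevK
    have hsumB : ∑ i ∈ Finset.Ico 0 (k - 1), (some (Msg.speaker k)).elim 0 cost =
        (k - 1 : ℕ) * cost (.speaker k) := by
      rw [Finset.sum_const, Nat.card_Ico, nsmul_eq_mul, Nat.sub_zero]
      rfl
    have hB0 : (0 : ℝ) ≤ (k - 1 : ℕ) * cost (.speaker k) := mul_nonneg (Nat.cast_nonneg _) hcsp.1
    have hB1 : (k - 1 : ℕ) * cost (.speaker k) ≤ n * hi :=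
      mul_le_mul (by exact_mod_cast (by omega)) hcsp.2 hcsp.1 (Nat.cast_nonneg _)
    rw [hsumB] at h6
    simp only [Nat.add_zero] at h6 h2
    rw [e, h5, h6, h2, hprevK]
    refine ⟨?_, by linarith, by linarith⟩
    congr 1
    funext a
    have hiff := dist_eq_iff L a (i := k - 1) (by omega)
    have hd := dist_lt L a
    simp only [← hiff, front, hst₁, e]
    split_ifs <;> first | rfl | omega

end Stage

/-! ### Phase 3: Step 2, whole stages, and termination. -/

section StepTwo

variable {n m : ℕ} {inp : Fin n → Input m} {cost : Msg m → ℝ} {lo hi : ℝ}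
  {L : Fin n} {P r S : ℕ} {A : Finset (Fin m)} {s : Fin n → AgentState m} {x : Option (Msg m)}

/-- The message with the list `l`, which is not sent if `l` is empty. -/
def colorMsg (l : Finset (Fin m)) : Option (Msg m) := if l = ∅ then none else some (.colors l)

theorem colorsOf_colorMsg (l : Finset (Fin m)) : colorsOf (colorMsg l) = l := by
  unfold colorMsg
  split_ifs with h
  · exact h.symm
  · rfl

/-- The states during Step 2 of stage `r`, before the agents have acted. -/
def waitingState (s : Fin n → AgentState m) (r S : ℕ) (a : Fin n) : AgentState m :=
  { s a with mode := .step2 S r }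

/-- The states during Step 2 of stage `r`, after the agents have acted. -/
def servedState (inp : Fin n → Input m) (L : Fin n) (s : Fin n → AgentState m) (r S : ℕ)
    (a : Fin n) : AgentState m :=
  { s a with mine := (s a).mine ∪ share inp L s r a, mode := .step2 S r }

theorem step2Act_serve (hs : StageVars L P A s) {a : Fin n} {d : ℕ} (hd : dist L a = d)
    (hx : colorsOf x = colorList inp L s r d) :
    step2Act n (inp a) (S + d) (waitingState s r S a) S r x =
      (servedState inp L s r S a, colorMsg (colorList inp L s r (d + 1)), none) := by
  subst hd
  have hlab : (waitingState s r S a).label = dist L a := hs.label a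
  unfold step2Act
  rw [colorList_dist_succ, if_pos (by rw [hlab]), hx]
  rfl

/-- Step 2 of a stage, up to the round `S + n` in which the complete list of colors is back at the
agent `L`, if Step 2 begins in round `S`, `K` is the first agent that can assign itself a color, and
the message that announces this is just arriving at the predecessor of `K`. -/
theorem step_two_collect (hn : 2 ≤ n) (hc : CostBounds inp cost lo hi)
    (hs : StageVars L P A s) {S₀ : ℕ} {K : Fin n} (hS : S = S₀ + n + dist L K - 1)
    (hmode : ∀ a, (s a).mode = .step1 S₀ r)
    (hrun : (syncBalance n m).run inp S =
      ⟨fun a => if a = prev K then s a else { s a with mode := .step2 S r },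
        toward (prev K) (some (.speaker (dist L K))), fun _ => none⟩) :
    (syncBalance n m).run inp (S + n) =
      ⟨servedState inp L s r S, toward L (colorMsg (colorList inp L s r n)), fun _ => none⟩ ∧
    (syncBalance n m).totalCost inp cost S ≤ (syncBalance n m).totalCost inp cost (S + n) ∧
    (syncBalance n m).totalCost inp cost (S + n) ≤ (syncBalance n m).totalCost inp cost S +
      (n * (hi * (colorList inp L s r n).card) + hi) := by
  have hK := dist_lt L K
  have hKprev : dist L (prev K) = if K = L then n - 1 else dist L K - 1 := by
    split_ifs with h
    · rw [h, prev_eq_iterate_next, dist_iterate_next L (by omega)]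
    · have h0 : dist L K ≠ 0 := fun h0 => h (dist_injective L (h0.trans (dist_self L).symm))
      have : prev K = next^[dist L K - 1] L := by
        apply next_injective
        rw [next_prev, ← Function.iterate_succ_apply' next, Nat.succ_eq_add_one,
          Nat.sub_add_cancel (by omega), iterate_next_dist]
      rw [this, dist_iterate_next L (by omega)]
  have hdL := dist_self L
  have hterm : ∀ i ≤ n, 0 ≤ (colorMsg (colorList inp L s r i)).elim 0 cost ∧
      (colorMsg (colorList inp L s r i)).elim 0 cost ≤ hi * (colorList inp L s r n).card := by
    intro i hin
    unfold colorMsg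
    split_ifs with h
    · exact ⟨le_rfl, mul_nonneg hc.hi_nonneg (Nat.cast_nonneg _)⟩
    · refine ⟨hc.nonneg _, (hc.colors_le _ (Finset.nonempty_iff_ne_empty.2 h)).trans ?_⟩
      exact mul_le_mul_of_nonneg_left
        (by exact_mod_cast Finset.card_le_card (colorList_mono hin)) hc.hi_nonneg
  have serveL : step2Act n (inp L) S (waitingState s r S L) S r none =
      (servedState inp L s r S L, colorMsg (colorList inp L s r 1), none) :=
    step2Act_serve hs hdL rfl
  -- In the first round of Step 2 two messages can be sent at once: `L` starts the list, and if `K =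
  -- L`, its predecessor still forwards the label. So the first two rounds are treated apart from
  -- the wave.
  set w : Fin n → Option (Msg m) := fun a =>
    if a = L then colorMsg (colorList inp L s r 1)
    else if a = prev K ∧ K = L then some (.speaker (dist L K)) else none with hw
  have h1 : (syncBalance n m).run inp (S + 1) =
      ⟨front L (waitingState s r S) (servedState inp L s r S) 1, w, fun _ => none⟩ := by
    refine run_succ_eq inp hrun fun a => ?_
    rw [toward_prev]
    have hdist : dist L a < 1 ↔ a = L := by
      rw [Nat.lt_one_iff, ← hdL]
      exact (dist_injective L).eq_iff
    have hstep2 : step2Act n (inp a) S (waitingState s r S a) S r none =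
        (front L (waitingState s r S) (servedState inp L s r S) 1 a,
          if a = L then colorMsg (colorList inp L s r 1) else none, none) := by
      simp only [front, hdist]
      by_cases haL : a = L
      · rw [if_pos haL, if_pos haL, haL, serveL]
      · rw [if_neg haL, if_neg haL, step2Act_wait]
        have : (waitingState s r S a).label = dist L a := hs.label a
        rw [← hdist] at haL
        omega
    by_cases hab : a = prev K
    · rw [if_pos hab, if_pos hab, act_step1 (hmode a)]
      by_cases hKL : K = L
      · have hda : dist L a = n - 1 := by rw [hab, hKprev, if_pos hKL]
        have hdK : dist L K = 0 := by rw [hKL, hdL]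
        have haL : ¬ a = L := by rw [← hdist]; omega
        have e : S = S₀ + dist L a := by omega
        have := step1Act_forward (n := n) (S := S₀) (i := inp a) (k := dist L K) (r := r)
          (hs.label a)
        rw [← e, (by omega : S + (n + dist L K - dist L a - 1) = S)] at this
        rw [this]
        simp only [hw, front, hdist, if_neg haL, if_pos (⟨hab, hKL⟩ : a = prev K ∧ K = L)]
        rfl
      -- The predecessor of `K` has its late turn, enters Step 2 without delay and swallows the
      -- label. If it is `L`, it also starts the list in this round.
      · have hda : dist L a = dist L K - 1 := by rw [hab, hKprev, if_neg hKL]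
        have h0 : dist L K ≠ 0 := fun h0 => hKL (dist_injective L (h0.trans hdL.symm))
        have e : S = S₀ + dist L a + n := by omega
        have := step1Act_last (n := n) (S := S₀) (i := inp a) (k := dist L K) (r := r)
          (hs.label a) (by omega) (by omega)
        rw [← e] at this
        rw [this]
        simp only [hw, hKL, and_false, if_false]
        exact hstep2
    · rw [if_neg hab, if_neg hab, act_step2 rfl]
      simp only [hw, hab, false_and, if_false]
      exact hstep2
  have h2 : (syncBalance n m).run inp (S + 2) =
      ⟨front L (waitingState s r S) (servedState inp L s r S) 2,
        toward (next^[2] L) (colorMsg (colorList inp L s r 2)), fun _ => none⟩ := by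
    refine run_succ_eq inp h1 fun a => ?_
    have hd1 : dist L a = 1 ↔ a = next L := dist_eq_iff L a (by omega)
    have hd0 : dist L a = 0 ↔ a = L := dist_eq_iff L a (by omega)
    have hto : toward (next^[2] L) (colorMsg (colorList inp L s r 2)) a =
        if a = next L then colorMsg (colorList inp L s r 2) else none := by
      simp only [toward, Function.iterate_succ_apply', Function.iterate_zero_apply,
        next_injective.eq_iff]
    rw [hto, front, front]
    by_cases ha1 : a = next L
    · have hd := hd1.2 ha1
      rw [if_neg (by omega), if_pos (by omega), if_pos ha1, act_step2 rfl, ha1, prev_next]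
      simp only [hw, if_true]
      rw [← ha1]
      exact step2Act_serve hs hd (colorsOf_colorMsg _)
    · by_cases ha0 : a = L
      · have hd := hd0.2 ha0
        -- A stray label may reach `L` here; in Step 2 only lists have an effect.
        rw [if_pos (by omega), if_pos (by omega), if_neg ha1, act_step2 rfl, step2Act_idle]
        · intro l
          have : prev a ≠ L := fun h => ha1 (by rw [← h, next_prev])
          simp only [hw, if_neg this]
          split_ifs <;> simp
        · have : (servedState inp L s r S a).label = dist L a := hs.label a
          omega
      · have hd : 2 ≤ dist L a := by
          rw [← hd1] at ha1
          rw [← hd0] at ha0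
          omega
        rw [if_neg (by omega), if_neg (by omega), if_neg ha1, act_step2 rfl, step2Act_wait]
        have : (waitingState s r S a).label = dist L a := hs.label a
        omega
  obtain ⟨h3, h4⟩ := sweep inp cost L S 2 n hn le_rfl (waitingState s r S)
    (servedState inp L s r S) (fun i => colorMsg (colorList inp L s r i))
    (fun a t _ h2 _ => by
      have : (waitingState s r S a).label = dist L a := hs.label a
      rw [act_step2 rfl, step2Act_wait]
      omega)
    (fun a _ _ => by
      rw [act_step2 rfl]
      exact step2Act_serve hs rfl (colorsOf_colorMsg _))
    (fun a t _ h2 _ => by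
      have : (servedState inp L s r S a).label = dist L a := hs.label a
      rw [act_step2 rfl, step2Act_idle (by simp)]
      omega)
    h2
  rw [front_card, iterate_next_card] at h3
  have hc2 := totalCost_succ inp cost h2
  rw [sum_toward] at hc2
  have hc1 := totalCost_succ inp cost h1
  have hw0 : 0 ≤ ∑ a, (w a).elim 0 cost := Finset.sum_nonneg fun a _ => by
    simp only [hw]
    split_ifs
    · exact (hterm 1 (by omega)).1
    · exact hc.nonneg _
    · exact le_rfl
  -- One list and at most one stray label.
  have hw1 : ∑ a, (w a).elim 0 cost ≤ hi * (colorList inp L s r n).card + hi := by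
    have hle : ∀ a, (w a).elim 0 cost ≤
        (if a = L then hi * (colorList inp L s r n).card else 0) +
          if a = prev K then hi else 0 := by
      intro a
      have hB := mul_nonneg hc.hi_nonneg (Nat.cast_nonneg (α := ℝ) (colorList inp L s r n).card)
      have hA := hc.hi_nonneg
      simp only [hw]
      by_cases haL : a = L
      · rw [if_pos haL, if_pos haL]
        have := (hterm 1 (by omega)).2
        split_ifs <;> linarith
      · rw [if_neg haL, if_neg haL]
        by_cases hab : a = prev K
        · rw [if_pos hab]
          split_ifs
          · have := hc.speaker (dist L K) hK.le
            simpa using this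
          · simpa using hA
        · simp [hab]
    refine (Finset.sum_le_sum fun a _ => hle a).trans ?_
    rw [Finset.sum_add_distrib, Finset.sum_ite_eq' Finset.univ, Finset.sum_ite_eq' Finset.univ]
    simp
  have hs0 : 0 ≤ ∑ i ∈ Finset.Ico 2 n, (colorMsg (colorList inp L s r (i + 1))).elim 0 cost :=
    Finset.sum_nonneg fun i hi' => (hterm _ (Nat.succ_le_of_lt (Finset.mem_Ico.1 hi').2)).1
  have hs1 : ∑ i ∈ Finset.Ico 2 n, (colorMsg (colorList inp L s r (i + 1))).elim 0 cost ≤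
      ((n : ℝ) - 2) * (hi * (colorList inp L s r n).card) := by
    refine (Finset.sum_le_sum fun i hi' =>
      (hterm _ (Nat.succ_le_of_lt (Finset.mem_Ico.1 hi').2)).2).trans ?_
    rw [Finset.sum_const, Nat.card_Ico, nsmul_eq_mul, Nat.cast_sub hn]
    rfl
  have ht2 := hterm 2 hn
  have e12 : S + 1 + 1 = S + 2 := rfl
  rw [e12] at hc2
  exact ⟨h3, by linarith, by linarith⟩

/-- A stage in which `K` is the first agent that can assign itself a color. -/
theorem AssignStage.productive (hn : 2 ≤ n) (hc : CostBounds inp cost lo hi)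
    (hsel : ∀ a, SelectsMax (inp a).choose) (h : AssignStage inp L P r S A s x) {K : Fin n}
    (hK : assignable n (inp K) (s K) r ≠ ∅)
    (hmin : ∀ a, dist L a < dist L K → assignable n (inp a) (s a) r = ∅) :
    ∃ S' A' s' x', S' ≤ S + 4 * n ∧ StageEnd inp L P r S' A' s' x' ∧
      (syncBalance n m).totalCost inp cost S + lo * n * (A'.card - A.card : ℝ) ≤
        (syncBalance n m).totalCost inp cost S' ∧
      (syncBalance n m).totalCost inp cost S' ≤ (syncBalance n m).totalCost inp cost S +
        5 * hi * n * (A'.card - A.card : ℝ) := by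
  obtain ⟨h1, h2, h3⟩ := h.speaker_wave hn hc hK hmin
  have hK' := dist_lt L K
  generalize hS₂ : S + n + dist L K - 1 = S₂ at h1 h2 h3
  obtain ⟨h4, h5, h6⟩ := step_two_collect hn hc h.toStageVars hS₂.symm h.mode h1
  have hne := colorList_nonempty hsel h.toStageVars hK
  have hcard := card_union_colorList (r := r) hsel h.toStageVars
  have hpa := h.partial_assignment.succ hsel h.toStageVars
  set l := colorList inp L s r n with hl
  have hmsg : colorMsg l = some (.colors l) := if_neg (Finset.nonempty_iff_ne_empty.1 hne)
  rw [hmsg] at h4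
  -- The complete list goes around once more. These `n` messages alone give the lower bound on the
  -- cost of the stage.
  obtain ⟨h7, h8⟩ := full_sweep inp cost L (S₂ + n) (servedState inp L s r S₂)
    (fun a => { servedState inp L s r S₂ a with
      assigned := A ∪ l, mode := modeAfter P r (S₂ + n + n) (A ∪ l) })
    (fun _ => some (.colors l))
    (fun a t h1 h2 => by
      have hd := dist_lt L a
      have : (servedState inp L s r S₂ a).label = dist L a := h.label a
      rw [act_step2 rfl, step2Act_idle (by simp)]
      omega)
    (fun a => by
      have hd := dist_lt L a
      have hlab : (servedState inp L s r S₂ a).label = dist L a := h.label a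
      have hass : (servedState inp L s r S₂ a).assigned = A := h.assigned a
      have hP : (servedState inp L s r S₂ a).pUB = P := h.pUB a
      rw [act_step2 rfl]
      generalize servedState inp L s r S₂ a = q at *
      have e : S₂ + n + dist L a + (n - q.label) = S₂ + n + n := by omega
      simp only [step2Act, nextStage, modeAfter]
      rw [if_neg (by omega), if_pos (by omega), e]
      simp only [hass, hP])
    (fun a t h1 h2 => by
      have : (servedState inp L s r S₂ a).label = dist L a := h.label a
      rw [act_modeAfter (P := P) (r := r) (S := S₂ + n + n) (A := A ∪ l) rfl]
      simp only
      omega)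
    h4
  refine ⟨S₂ + n + n, A ∪ l, fun a => { servedState inp L s r S₂ a with
      assigned := A ∪ l, mode := modeAfter P r (S₂ + n + n) (A ∪ l) }, some (.colors l), by omega,
    ⟨⟨h.label, h.pUB, fun _ => rfl⟩, h7, by simp,
    fun _ => rfl, hpa⟩, ?_, ?_⟩
  all_goals
    rw [h8, Finset.sum_const, Finset.card_range, nsmul_eq_mul, hcard, Option.elim_some,
      Nat.cast_add, add_sub_cancel_left]
  · have := mul_le_mul_of_nonneg_left (hc.le_colors l) (Nat.cast_nonneg (α := ℝ) n)
    linarith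
  -- The factor `5`: two laps of labels, the lap that collects the list, the stray label, and the
  -- lap that distributes the list; the parts without colors are absorbed by `1 ≤ l.card`.
  · have hlow := mul_le_mul_of_nonneg_left (hc.colors_le l hne) (Nat.cast_nonneg (α := ℝ) n)
    have hone : (1 : ℝ) ≤ l.card := by exact_mod_cast Finset.card_pos.2 hne
    have hn' : (1 : ℝ) ≤ n := by exact_mod_cast (by omega : 1 ≤ n)
    have h0 := hc.hi_nonneg
    have ha : hi * n ≤ hi * n * l.card := le_mul_of_one_le_right (by positivity) hone
    have hb : hi ≤ hi * n := le_mul_of_one_le_right h0 hn'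
    nlinarith

/-- Either the agent of least label that can take a color plays the part of `K`, or the stage is
silent, assigns nothing and costs nothing. In both cases the cost is governed by the number of new
colors. -/
theorem AssignStage.exists_stageEnd (hn : 2 ≤ n) (hc : CostBounds inp cost lo hi)
    (hsel : ∀ a, SelectsMax (inp a).choose) (h : AssignStage inp L P r S A s x)
    (hA : A ≠ Finset.univ) :
    ∃ S' A' s' x', S' ≤ S + 4 * n ∧ StageEnd inp L P r S' A' s' x' ∧
      (syncBalance n m).totalCost inp cost S + lo * n * (A'.card - A.card : ℝ) ≤
        (syncBalance n m).totalCost inp cost S' ∧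
      (syncBalance n m).totalCost inp cost S' ≤ (syncBalance n m).totalCost inp cost S +
        5 * hi * n * (A'.card - A.card : ℝ) := by
  by_cases hex : ∃ a, assignable n (inp a) (s a) r ≠ ∅
  · obtain ⟨K, hK, hmin⟩ := exists_minimalFor_of_wellFoundedLT
      (fun a => assignable n (inp a) (s a) r ≠ ∅) (dist L) hex
    refine h.productive hn hc hsel hK fun a ha => ?_
    by_contra hne
    exact absurd (hmin hne ha.le) (not_le.2 ha)
  · obtain ⟨s', h1, h2⟩ := h.silent (cost := cost) hA fun a => by
      by_contra hne
      exact hex ⟨a, hne⟩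
    exact ⟨_, A, s', none, by omega, h1, by simp [h2], by simp [h2]⟩

/-- Phase 3 ends with all colors assigned. -/
theorem AssignStage.exists_halted (hn : 2 ≤ n) (hc : CostBounds inp cost lo hi)
    (hsel : ∀ a, SelectsMax (inp a).choose) {e : ℕ} (he : 0 < e) (k : ℕ) (hk : r + k = e)
    (h : AssignStage inp L (2 ^ e) r S A s x) (hA : A ≠ Finset.univ) :
    ∃ T s' r', T ≤ S + 4 * n * (k + 1) ∧ (∀ a, (s' a).mode = .halted) ∧
      ((syncBalance n m).run inp T).state = s' ∧
      PartialAssignment inp L (2 ^ e) r' Finset.univ (fun a => (s' a).mine) ∧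
      (syncBalance n m).totalCost inp cost S + lo * n * (m - A.card : ℝ) ≤
        (syncBalance n m).totalCost inp cost T ∧
      (syncBalance n m).totalCost inp cost T ≤ (syncBalance n m).totalCost inp cost S +
        5 * hi * n * (m - A.card : ℝ) := by
  have hlog : Nat.log 2 (2 ^ e) = e := Nat.log_pow (by norm_num) _
  induction k generalizing r S A s x with
  | zero =>
    obtain ⟨S', A', s', x', h1, h2, h3, h4⟩ := h.exists_stageEnd hn hc hsel hA
    obtain rfl : r = e := by omega
    -- Stage `e` is the last one, so nothing is left and the agents halt with a complete assignment.
    obtain rfl := h2.partial_assignment.eq_univ he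
    rw [Finset.card_univ, Fintype.card_fin] at h3 h4
    exact ⟨S', s', r + 1, by omega, fun a => by rw [h2.mode, modeAfter, if_pos rfl],
      by rw [h2.run], h2.partial_assignment, h3, h4⟩
  | succ k ih =>
    obtain ⟨S', A', s', x', h1, h2, h3, h4⟩ := h.exists_stageEnd hn hc hsel hA
    have hk4 : 4 * n * (k + 1 + 1) = 4 * n * (k + 1) + 4 * n := by ring
    by_cases hA' : A' = Finset.univ
    · subst hA'
      rw [Finset.card_univ, Fintype.card_fin] at h3 h4
      exact ⟨S', s', r + 1, by omega, fun a => by rw [h2.mode, modeAfter, if_pos rfl],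
        by rw [h2.run], h2.partial_assignment, h3, h4⟩
    · obtain ⟨T, q, r', i1, i2, i3, i4, i5, i6⟩ := ih (r := r + 1) (by omega)
        ⟨h2.toStageVars, h2.run, h2.no_speaker, fun a => by
          rw [h2.mode, modeAfter, if_neg hA', if_pos (by omega)], h2.partial_assignment⟩ hA'
      exact ⟨T, q, r', by omega, i2, i3, i4, by linarith, by linarith⟩

end StepTwo

/-! ### From bit lengths to charges. -/

section Charges

variable {n m : ℕ} {cBasic cLong : ℝ}

theorem one_le_logb_two (hn : 2 ≤ n) : 1 ≤ Real.logb 2 n := by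
  rw [Real.le_logb_iff_rpow_le (by norm_num) (by positivity), Real.rpow_one]
  exact_mod_cast hn

theorem bitCost_nonneg (hLong : 0 < cLong) (L : ℕ) : 0 ≤ bitCost cBasic cLong n L := by
  unfold bitCost
  split_ifs
  · exact zero_le_one
  · positivity

theorem bitCost_le (hLong : 0 < cLong) (hn : 2 ≤ n) {L : ℕ} {a : ℝ} (ha : 0 ≤ a)
    (hL : (L : ℝ) ≤ a * Real.logb 2 n) : bitCost cBasic cLong n L ≤ 1 + cLong * (a + 1) := by
  have hlog : 0 < Real.logb 2 n := zero_lt_one.trans_le (one_le_logb_two hn)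
  unfold bitCost
  split_ifs
  · have : 0 ≤ cLong * (a + 1) := by positivity
    linarith
  · have h1 : (L : ℝ) / Real.logb 2 n ≤ a := (div_le_iff₀ hlog).2 hL
    have h2 := (Nat.ceil_lt_add_one (div_nonneg (Nat.cast_nonneg L) hlog.le)).le
    have h3 := mul_le_mul_of_nonneg_left (h2.trans (add_le_add_left h1 1)) hLong.le
    linarith

/-- A message charged `1` has room for at most `cBasic` blocks of `log n` bits, so each block still
accounts for `cBasic⁻¹`; in a longer message each accounts for `cLong`. -/
theorem le_bitCost (hBasic : 0 < cBasic) (hLong : 0 < cLong) (hn : 2 ≤ n) {L k : ℕ}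
    (hL : k * Real.logb 2 n ≤ L) : min cLong cBasic⁻¹ * k ≤ bitCost cBasic cLong n L := by
  have hlog : 0 < Real.logb 2 n := zero_lt_one.trans_le (one_le_logb_two hn)
  have hk := Nat.cast_nonneg (α := ℝ) k
  unfold bitCost
  split_ifs with h
  · have hkb : (k : ℝ) ≤ cBasic := le_of_mul_le_mul_right (hL.trans h) hlog
    calc min cLong cBasic⁻¹ * k ≤ cBasic⁻¹ * cBasic :=
          mul_le_mul (min_le_right _ _) hkb hk (inv_nonneg.2 hBasic.le)
      _ = 1 := inv_mul_cancel₀ hBasic.ne'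
  · have h1 : (k : ℝ) ≤ L / Real.logb 2 n := (le_div_iff₀ hlog).2 hL
    exact mul_le_mul (min_le_left _ _) (h1.trans (Nat.le_ceil _)) hk hLong.le

/-- The code has at most `2 (j log n + 1) + 2` bits, and `1 ≤ log n` absorbs the constants. -/
theorem natBits_le (hn : 2 ≤ n) {x j : ℕ} (hx : x ≤ n ^ j) :
    (natBits x : ℝ) ≤ (2 * j + 4) * Real.logb 2 n := by
  have h1 := one_le_logb_two hn
  have hsize : (Nat.size x : ℝ) ≤ j * Real.logb 2 n + 1 := by
    rcases Nat.eq_zero_or_pos (Nat.size x) with h0 | h0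
    · rw [h0, Nat.cast_zero]; positivity
    · have h2 : 2 ^ (Nat.size x - 1) ≤ n ^ j := (Nat.lt_size.1 (by omega)).trans hx
      have h3 : ((Nat.size x - 1 : ℕ) : ℝ) ≤ j * Real.logb 2 n := by
        rw [← Real.logb_pow, Real.le_logb_iff_rpow_le (by norm_num) (by positivity),
          Real.rpow_natCast]
        exact_mod_cast h2
      rw [Nat.cast_sub h0, Nat.cast_one] at h3
      linarith
  simp only [natBits]
  push_cast
  linarith

/-- In units of `log n`, a probe takes at most `(2e + 4) + 6 + 6 + 3 = 2e + 19` for identifier, two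
numbers and kind, and `q > 0` colors take at most `(|log C| + |c| + 4) q`. The upper constant covers
both. Absolute values are taken because `log C` and `c` may be negative. -/
theorem costBounds (hBasic : 0 < cBasic) (hLong : 0 < cLong) (hn : 2 ≤ n) (hnm : n ≤ m)
    {C c : ℝ} (hm : (m : ℝ) ≤ C * (n : ℝ) ^ c) {e : ℕ} {inp : Fin n → Input m}
    (hid : ∀ a, (inp a).id < n ^ e) :
    CostBounds inp (fun x => bitCost cBasic cLong n x.bits) (min cLong cBasic⁻¹)
      (1 + cLong * (2 * e + |Real.logb 2 C| + |c| + 24)) := by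
  have hlog := one_le_logb_two hn
  have hn0 : (0 : ℝ) < n := by positivity
  have hm0 : (0 : ℝ) < m := by exact_mod_cast (by omega : 0 < m)
  have hC : 0 < C := by
    have := hm0.trans_le hm
    exact pos_of_mul_pos_left this (Real.rpow_nonneg hn0.le c)
  have habs : 0 ≤ |Real.logb 2 C| ∧ 0 ≤ |c| := ⟨abs_nonneg _, abs_nonneg _⟩
  have he : (0 : ℝ) ≤ e := Nat.cast_nonneg e
  have small : ∀ L : ℕ, (L : ℝ) ≤ (2 * e + 19) * Real.logb 2 n → bitCost cBasic cLong n L ≤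
      1 + cLong * (2 * e + |Real.logb 2 C| + |c| + 24) := by
    intro L hL
    refine (bitCost_le hLong hn (by positivity) hL).trans ?_
    have := mul_le_mul_of_nonneg_left (by linarith : (2 * (e : ℝ) + 19 + 1) ≤
      2 * e + |Real.logb 2 C| + |c| + 24) hLong.le
    linarith
  have nat1 : ∀ x ≤ n, (natBits x : ℝ) ≤ 6 * Real.logb 2 n := by
    intro x hx
    have := natBits_le hn (j := 1) (by simpa using hx)
    norm_num at this
    exact this
  have nate : ∀ a, (natBits (inp a).id : ℝ) ≤ (2 * e + 4) * Real.logb 2 n :=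
    fun a => natBits_le hn (hid a).le
  have helog : 0 ≤ e * Real.logb 2 n := by positivity
  have hclog : (Nat.clog 2 m : ℝ) ≤ (|Real.logb 2 C| + |c| + 1) * Real.logb 2 n := by
    have h1 : 2 ^ (Nat.clog 2 m - 1) ≤ m :=
      (Nat.pow_pred_clog_lt_self (by norm_num) (by omega)).le
    have h2 : ((Nat.clog 2 m - 1 : ℕ) : ℝ) ≤ Real.logb 2 (C * (n : ℝ) ^ c) := by
      rw [Real.le_logb_iff_rpow_le (by norm_num) (by positivity), Real.rpow_natCast]
      exact le_trans (by exact_mod_cast h1) hm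
    rw [Real.logb_mul hC.ne' (by positivity), Real.logb_rpow_eq_mul_logb_of_pos hn0,
      Nat.cast_sub (Nat.clog_pos (by norm_num) (by omega)), Nat.cast_one] at h2
    have h3 : Real.logb 2 C ≤ |Real.logb 2 C| * Real.logb 2 n :=
      (le_abs_self _).trans (le_mul_of_one_le_right habs.1 hlog)
    have h4 : c * Real.logb 2 n ≤ |c| * Real.logb 2 n :=
      mul_le_mul_of_nonneg_right (le_abs_self c) (by linarith)
    linarith
  refine ⟨fun x => bitCost_nonneg hLong _, by positivity, fun b k d hk hd => small _ ?_,
    fun b k hk => small _ ?_, fun i hi => small _ ?_, fun i hi => small _ ?_, small _ ?_,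
    fun i hi => small _ ?_, fun l hl => ?_, fun l => le_bitCost hBasic hLong hn ?_⟩
  · have h1 := nate b
    have h2 := nat1 k hk
    have h3 := nat1 d hd
    simp only [Msg.bits]
    push_cast
    linarith
  · have h1 := nate b
    have h2 := nat1 k hk
    simp only [Msg.bits]
    push_cast
    linarith
  · have h2 := nat1 i hi
    simp only [Msg.bits]
    push_cast
    linarith
  · have h2 := nat1 i hi
    simp only [Msg.bits]
    push_cast
    linarith
  · simp only [Msg.bits]
    push_cast
    linarith
  · have h2 := nat1 i hi
    simp only [Msg.bits]
    push_cast
    linarith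
  · have hcard : (1 : ℝ) ≤ l.card := by exact_mod_cast Finset.card_pos.2 hl
    have hL : ((Msg.colors l).bits : ℝ) ≤
        ((|Real.logb 2 C| + |c| + 4) * l.card) * Real.logb 2 n := by
      simp only [Msg.bits]
      push_cast
      have h1 := mul_le_mul_of_nonneg_left hclog (Nat.cast_nonneg (α := ℝ) l.card)
      have h2 : 1 ≤ l.card * Real.logb 2 n := one_le_mul_of_one_le_of_one_le hcard hlog
      linarith
    refine (bitCost_le hLong hn (by positivity) hL).trans ?_
    have h1 : cLong * 1 ≤ cLong * l.card := mul_le_mul_of_nonneg_left hcard hLong.le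
    have h2 : 0 ≤ cLong * e * l.card := by positivity
    have h3 : 0 ≤ cLong * l.card := by positivity
    linarith
  · simp only [Msg.bits]
    push_cast
    -- As `n ≤ m`, every color occupies at least `log n` bits; the lower bound rests on this.
    have h1 : Real.logb 2 n ≤ Nat.clog 2 m := by
      rw [Real.logb_le_iff_le_rpow (by norm_num) hn0, Real.rpow_natCast]
      exact_mod_cast hnm.trans (Nat.le_pow_clog (by norm_num) m)
    have := mul_le_mul_of_nonneg_left h1 (Nat.cast_nonneg (α := ℝ) l.card)
    linarith

end Charges

/-! ### Combination of the phases. -/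

section Main

variable {n m : ℕ} {inp : Fin n → Input m} {cost : Msg m → ℝ} {lo hi : ℝ}

theorem totalCost_nonneg (hc : CostBounds inp cost lo hi) (t : ℕ) :
    0 ≤ (syncBalance n m).totalCost inp cost t := by
  have h : ∀ x : Option (Msg m), 0 ≤ x.elim 0 cost := by
    rintro (_ | x)
    · exact le_rfl
    · exact hc.nonneg x
  exact Finset.sum_nonneg fun _ _ => Finset.sum_nonneg fun _ _ => add_nonneg (h _) (h _)

/-- Sync-Balance halts with a Balanced Coloring; bounds on its time and its cost. -/
theorem syncBalance_correct (hn : 2 ≤ n) (hnm : n ≤ m)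
    (hinj : Function.Injective fun a => (inp a).id) (hc : CostBounds inp cost lo hi)
    (hsel : ∀ a, SelectsMax (inp a).choose) :
    ∃ T, (∀ a, (((syncBalance n m).run inp T).state a).mode = .halted) ∧
      (∃ π : Fin m → Fin n, IsBalancedColoring π ∧
        ∀ a j, j ∈ (((syncBalance n m).run inp T).state a).mine ↔ π j = a) ∧
      T ≤ n * (5 * Nat.log 2 (maxWeight inp) + 17) ∧
      lo * (m * n) ≤ (syncBalance n m).totalCost inp cost T ∧
      (syncBalance n m).totalCost inp cost T ≤ 19 * hi * (m * n) := by
  obtain ⟨L, E, s, hE, hrun, hs, hcost⟩ := phase_one hn hinj hc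
  obtain ⟨S, s', hS, hrun', hs', hcost'⟩ := phase_two hc hrun hs
  have hne : (∅ : Finset (Fin m)) ≠ Finset.univ := by
    have : Nonempty (Fin m) := ⟨⟨0, by omega⟩⟩
    exact Finset.univ_nonempty.ne_empty.symm
  have hmine : (fun a => (s' a).mine) = fun _ => ∅ := funext fun a => (hs' a).2.2.2.2
  have hstage : AssignStage inp L (2 ^ (Nat.log 2 (maxWeight inp) + 1)) 0 S ∅ s' none :=
    ⟨⟨fun a => (hs' a).2.1, fun a => (hs' a).2.2.1, fun a => (hs' a).2.2.2.1⟩, hrun', by simp,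
      fun a => (hs' a).1, by rw [hmine]; exact PartialAssignment.empty⟩
  obtain ⟨T, q, r', hT, hhalt, hq, hpa, hlow, hupp⟩ := hstage.exists_halted hn hc hsel
    (Nat.succ_pos _) _ (Nat.zero_add _) hne
  refine ⟨T, by rw [hq]; exact hhalt, by rw [hq]; exact hpa.exists_balancedColoring, ?_, ?_, ?_⟩
  -- The phases take at most `6 n`, `(l + 2) n + 1` and `4 n (l + 2)` rounds.
  · generalize Nat.log 2 (maxWeight inp) = l at *
    nlinarith
  · have := totalCost_nonneg hc S
    rw [Finset.card_empty, Nat.cast_zero, sub_zero] at hlow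
    linarith
  -- The factor `19 = 12 + 1 + 1 + 5` comes from `2 n` messages in each of at most `6 n` rounds, the
  -- counts, the end marker, and Phase 3.
  · rw [Finset.card_empty, Nat.cast_zero, sub_zero] at hupp
    have h0 := hc.hi_nonneg
    have hE' : (E : ℝ) ≤ 6 * n := by exact_mod_cast hE
    have hm' : (n : ℝ) ≤ m := by exact_mod_cast hnm
    have hn1 : (1 : ℝ) ≤ n := by exact_mod_cast (by omega : 1 ≤ n)
    have h1 := mul_le_mul_of_nonneg_left hE' (by positivity : 0 ≤ 2 * n * hi)
    have h2 := mul_le_mul_of_nonneg_left hm' (by positivity : 0 ≤ hi * n)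
    have h3 := mul_le_mul_of_nonneg_left (hn1.trans hm') (by positivity : 0 ≤ hi * n)
    linarith

end Main

end SyncBalance

theorem theorem15 (C c : ℝ) (e : ℕ) (cBasic cLong : ℝ) (hBasic : 0 < cBasic) (hLong : 0 < cLong) :
    ∃ KT K₁ K₂ : ℝ, 0 < KT ∧ 0 < K₁ ∧ 0 < K₂ ∧
      ∀ n m : ℕ, 2 ≤ n → n ≤ m → (m : ℝ) ≤ C * (n : ℝ) ^ c →
      ∀ id : Fin n → ℕ, Function.Injective id → (∀ a, id a < n ^ e) →
      ∀ Q : Fin m → Fin n → ℕ,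
      ∀ choose : Fin n → Finset (Fin m) → ℕ → Finset (Fin m),
        (∀ a, SyncBalance.SelectsMax (choose a)) →
      ∃ T : ℕ,
        (∀ a, ((SyncBalance.config id Q choose T).state a).mode = SyncBalance.Mode.halted) ∧
        (∃ π : Fin m → Fin n, SyncBalance.IsBalancedColoring π ∧
          ∀ a j, j ∈ ((SyncBalance.config id Q choose T).state a).mine ↔ π j = a) ∧
        (T : ℝ) ≤ KT * ((n : ℝ) * Real.logb 2 (max (SyncBalance.maxItems Q : ℝ) 2)) ∧
        K₁ * ((m : ℝ) * n) ≤ SyncBalance.messageCost cBasic cLong id Q choose T ∧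
        SyncBalance.messageCost cBasic cLong id Q choose T ≤ K₂ * ((m : ℝ) * n) := by
  -- Here `22 = 5 + 17`, since both `Nat.log 2 p` and `1` are at most `log (max p 2)`.
  refine ⟨22, min cLong cBasic⁻¹, 19 * (1 + cLong * (2 * e + |Real.logb 2 C| + |c| + 24)),
    by norm_num, lt_min hLong (inv_pos.2 hBasic), by positivity, ?_⟩
  intro n m hn hnm hm id hinj hid Q choose hsel
  obtain ⟨T, h1, h2, h3, h4, h5⟩ := SyncBalance.syncBalance_correct
    (inp := SyncBalance.inputs id Q choose) hn hnm hinj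
    (SyncBalance.costBounds hBasic hLong hn hnm hm hid) hsel
  refine ⟨T, h1, h2, ?_, h4, h5⟩
  have hp : SyncBalance.maxWeight (SyncBalance.inputs id Q choose) = SyncBalance.maxItems Q := rfl
  rw [hp] at h3
  generalize SyncBalance.maxItems Q = p at h3
  have hX1 : 1 ≤ Real.logb 2 (max (p : ℝ) 2) := by
    rw [Real.le_logb_iff_rpow_le (by norm_num) (by positivity), Real.rpow_one]
    exact le_max_right _ _
  have hX : (Nat.log 2 p : ℝ) ≤ Real.logb 2 (max (p : ℝ) 2) := by
    rcases Nat.eq_zero_or_pos p with rfl | hpos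
    · rw [Nat.log_zero_right]
      exact (Nat.cast_zero (R := ℝ)).le.trans (zero_le_one.trans hX1)
    · rw [Real.le_logb_iff_rpow_le (by norm_num) (by positivity), Real.rpow_natCast]
      exact le_max_of_le_left (by exact_mod_cast Nat.pow_log_le_self 2 hpos.ne')
  have h3' : (T : ℝ) ≤ n * (5 * Nat.log 2 p + 17) := by exact_mod_cast h3
  have := mul_le_mul_of_nonneg_left
    (by linarith : 5 * (Nat.log 2 p : ℝ) + 17 ≤ 22 * Real.logb 2 (max (p : ℝ) 2))
    (Nat.cast_nonneg (α := ℝ) n)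
  linarith
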